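/- For a positive integer $k$ and a finite simple graph $H$, let $\#_k\mathrm{HomsTo}H$ be the problem: given a finite simple graph $G$, compute the number of graph homomorphisms from $G$ to $H$ modulo $k$. Let $\#_k\mathsf{P}$ be the class of problems of the form "compute $f(x)$ modulo $k$" where $f\in\#\mathsf{P}$; a counting problem is $\#_k\mathsf{P}$-hard if every problem in $\#_k\mathsf{P}$ reduces to it via a polynomial time Turing reduction, that is, by a polynomial time deterministic oracle Turing machine. **Theorem.** Let $p$ be a prime and let $H$ be a finite simple graph (undirected, without loops or parallel edges) that has no automorphism of order $p$. If $H_1$ is a connected component of $H$ and $\#_p\mathrm{HomsTo}H_1$ is $\#_p\mathsf{P}$-hard, then $\#_p\mathrm{HomsTo}H$ is $\#_p\mathsf{P}$-hard. -/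

import Mathlib

/-- The four communication stacks of an oracle machine. Each of them holds bits. -/
inductive Port
  | input
  | output
  | query
  | answer
  deriving DecidableEq

instance : Fintype Port where
  elems := {.input, .output, .query, .answer}
  complete x := by cases x <;> decide

/-- The alphabet of each stack of an oracle machine: bits on the communication stacks, and
an alphabet `Γ k` of the machine's own choice on its `k`-th work stack. -/
abbrev stackAlphabet {K : Type} (Γ : K → Type) : Port ⊕ K → Type
  | .inl _ => Bool
  | .inr k => Γ k

/-- A deterministic oracle Turing machine with finitely many tapes, finite alphabets and a finite
control, in the style of `Turing.FinTM2`: tapes are presented as stacks (a two-way tape is a pair of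
stacks, one on either side of the head), and the code at each label is a statement of
`Turing.TM2`. The labels `l` with `resume l = some l'` are the query states: there the oracle
is consulted, and the computation continues at `l'`. -/
structure OracleMachine where
  /-- the work stacks -/
  K : Type
  [decEqK : DecidableEq K]
  [finiteK : Finite K]
  /-- the alphabets of the work stacks -/
  Γ : K → Type
  [finiteΓ : ∀ k, Finite (Γ k)]
  /-- the labels of the program -/
  Λ : Type
  [finiteΛ : Finite Λ]
  /-- the internal memory of the finite control -/
  σ : Type
  [finiteσ : Finite σ]
  /-- the label at which the computation starts -/
  start : Λ
  /-- the initial content of the internal memory -/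
  initialState : σ
  /-- the code executed at a label that is not a query state -/
  program : Λ → Turing.TM2.Stmt (stackAlphabet Γ) Λ σ
  /-- `some l'` at a query state with successor `l'`, and `none` at every other label -/
  resume : Λ → Option Λ

namespace OracleMachine

attribute [instance] decEqK finiteK finiteΓ finiteΛ finiteσ

/-- Configurations: the current label (`none` once the machine has halted), the internal memory,
and the contents of all the stacks, listed from the top. -/
abbrev Cfg (M : OracleMachine) : Type :=
  Turing.TM2.Cfg (stackAlphabet M.Γ) M.Λ M.σ

/-- The initial configuration on the input string `w`: all the other stacks are empty. -/
def init (M : OracleMachine) (w : List Bool) : M.Cfg where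
  l := some M.start
  var := M.initialState
  stk
    | .inl .input => w
    | .inl _ => []
    | .inr _ => []

/-- One step of `M` with oracle `O`. In a query state the string on the query stack is removed and
the answer stack is made to hold the oracle's answer to it, in a single step. The machine gets stuck
on a string that is not a legitimate query (`O w = none`). -/
def step (M : OracleMachine) (O : List Bool → Option (List Bool)) : M.Cfg → Option M.Cfg
  | ⟨none, _, _⟩ => none
  | ⟨some l, v, S⟩ =>
    match M.resume l with
    | none => some (Turing.TM2.stepAux (M.program l) v S)
    | some l' =>
      (O (S (.inl .query))).map fun a =>
        ⟨some l', v,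
          Function.update (Function.update S (.inl .query) []) (.inl .answer) a⟩

/-- With oracle `O` and input `w`, the machine `M` halts after at most `t` steps with the
string `y` on its output stack. -/
def OutputsWithin (M : OracleMachine) (O : List Bool → Option (List Bool))
    (w y : List Bool) (t : ℕ) : Prop :=
  ∃ c : M.Cfg, Nonempty (StateTransition.EvalsToInTime (M.step O) (M.init w) (some c) t) ∧
    c.l = none ∧ c.stk (.inl .output) = y

end OracleMachine

/-- A counting problem: its instances, their encoding as bit strings, and the number that has to
be computed for each instance. -/
structure CountingProblem where
  Instance : Type
  encode : Instance → List Bool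
  encode_injective : Function.Injective encode
  value : Instance → ℕ

namespace CountingProblem

open Classical in
/-- The oracle for a counting problem: it answers (the encoding of) an instance with the value of
that instance, written in binary. Strings that encode no instance are not legitimate queries. -/
noncomputable def oracle (Q : CountingProblem) (w : List Bool) : Option (List Bool) :=
  if h : ∃ x, Q.encode x = w then some (Computability.encodeNat (Q.value h.choose)) else none

theorem oracle_encode (Q : CountingProblem) (x : Q.Instance) :
    Q.oracle (Q.encode x) = some (Computability.encodeNat (Q.value x)) := by
  have h : ∃ y, Q.encode y = Q.encode x := ⟨x, rfl⟩
  rw [oracle, dif_pos h, Q.encode_injective h.choose_spec]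

/-- `P` reduces to `Q` via polynomial time Turing reduction: some oracle machine outputs, on every
instance of `P`, its value in binary, in time polynomial in the length of the encoded
instance, by making queries to the oracle for `Q`. -/
def TuringReducesTo (P Q : CountingProblem) : Prop :=
  ∃ (M : OracleMachine) (q : Polynomial ℕ), ∀ x : P.Instance,
    M.OutputsWithin Q.oracle (P.encode x) (Computability.encodeNat (P.value x))
      (q.eval (P.encode x).length)

/-- The problem of computing a function on all bit strings. -/
def ofFun (f : List Bool → ℕ) : CountingProblem where
  Instance := List Bool
  encode := id
  encode_injective := Function.injective_id
  value := f

end CountingProblem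

/-- A pair of bit strings as one string, with `none` as separator. -/
def encodePair (w : List Bool × List Bool) : List (Option Bool) :=
  w.1.map some ++ none :: w.2.map some

/-- The class `#P`: the functions that count, for each input `w`, the witnesses `y` of length
`q(|w|)` that a polynomial time verifier `R` accepts, for some polynomial `q`. -/
def IsSharpP (f : List Bool → ℕ) : Prop :=
  ∃ (R : List Bool × List Bool → Bool) (q : Polynomial ℕ),
    Nonempty (Turing.TM2ComputableInPolyTime encodePair Computability.encodeBool R) ∧
    ∀ w, f w = Nat.card {y : List Bool // y.length = q.eval w.length ∧ R (w, y) = true}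

/-- The class `#ₖP`: the problems "compute `f(w)` modulo `k`" where `f` is in `#P`. -/
def IsSharpModP (k : ℕ) (g : List Bool → ℕ) : Prop :=
  ∃ f : List Bool → ℕ, IsSharpP f ∧ ∀ w, g w = f w % k

/-- `Q` is `#ₖP`-hard: every problem in `#ₖP` reduces to `Q` via polynomial time Turing
reduction. -/
def IsSharpModPHard (k : ℕ) (Q : CountingProblem) : Prop :=
  ∀ g : List Bool → ℕ, IsSharpModP k g → (CountingProblem.ofFun g).TuringReducesTo Q

open Classical in
/-- The encoding of a graph on the vertices `0, …, n - 1`: the number `n` in unary, ended by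
`false`, and then the rows of the adjacency matrix. -/
noncomputable def encodeGraph (G : Σ n : ℕ, SimpleGraph (Fin n)) : List Bool :=
  List.replicate G.1 true ++ false ::
    (List.ofFn fun i => List.ofFn fun j => decide (G.2.Adj i j)).flatten

theorem encodeGraph_injective : Function.Injective encodeGraph := by
  classical
  have key : ∀ (n m : ℕ) (a b : List Bool),
      List.replicate n true ++ false :: a = List.replicate m true ++ false :: b →
        n = m ∧ a = b := by
    intro n
    induction n with
    | zero =>
      intro m a b h
      cases m with
      | zero => simpa using h
      | succ m => simp [List.replicate_succ] at h
    | succ n ih =>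
      intro m a b h
      cases m with
      | zero => simp [List.replicate_succ] at h
      | succ m =>
        simp only [List.replicate_succ, List.cons_append, List.cons.injEq, true_and] at h
        obtain ⟨h1, h2⟩ := ih m a b h
        exact ⟨by rw [h1], h2⟩
  have flat : ∀ (n : ℕ) (L L' : List (List Bool)), L.length = L'.length →
      (∀ r ∈ L, r.length = n) → (∀ r ∈ L', r.length = n) → L.flatten = L'.flatten →
        L = L' := by
    intro n L
    induction L with
    | nil =>
      intro L' h _ _ _
      exact (List.length_eq_zero_iff.mp h.symm).symm
    | cons r L ih =>
      intro L' h h1 h2 h3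
      cases L' with
      | nil => simp at h
      | cons r' L' =>
        simp only [List.flatten_cons] at h3
        obtain ⟨e1, e2⟩ := List.append_inj h3
          ((h1 r List.mem_cons_self).trans (h2 r' List.mem_cons_self).symm)
        rw [e1, ih L' (by simpa using h) (fun s hs => h1 s (List.mem_cons_of_mem _ hs))
          (fun s hs => h2 s (List.mem_cons_of_mem _ hs)) e2]
  rintro ⟨n, G⟩ ⟨m, G'⟩ h
  obtain ⟨hnm, h'⟩ := key _ _ _ _ h
  dsimp only at hnm
  subst hnm
  have h2 := flat n _ _ (by simp) (by simp [List.mem_ofFn]) (by simp [List.mem_ofFn]) h'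
  have h3 := List.ofFn_injective h2
  congr 1
  ext i j
  have h4 := congrFun (List.ofFn_injective (congrFun h3 i)) j
  simpa using h4

/-- The problem `#ₖHomsTo H`: given a (finite, simple) graph `G`, compute the number of
homomorphisms from `G` to `H` modulo `k`. -/
noncomputable def homsToMod {V : Type*} (k : ℕ) (H : SimpleGraph V) : CountingProblem where
  Instance := Σ n : ℕ, SimpleGraph (Fin n)
  encode := encodeGraph
  encode_injective := encodeGraph_injective
  value G := Nat.card (G.2 →g H) % k

/-! By Cauchy's theorem `p` does not divide |Aut H|. Let `G` be connected with a vertex `v`, so that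
the homomorphisms from `G` to the component `H₁` are the `f : G → H` with `f v` in `H₁`. Gluing a
rooted graph `J` to `G` at `v` gives a graph with Σ_f #{b : J → H | b(root) = f v} homomorphisms to
`H`. An oracle for `H` therefore yields Σ_f F(f v) mod `p` for every `F` in the span of the
functions w ↦ #{b : J → H | b(root) = w} (`countSpan`).

These functions are invariant under Aut H, so the indicator of `H₁` need not lie in their span; its
average over Aut H does. That average is |Aut H|⁻¹ Σ_{h ∈ H₁} #{φ | φ h = w}. Automorphisms of a
finite graph are its injective endomorphisms, and inclusion-exclusion over identified pairs of
vertices writes the number of these with h ↦ w through homomorphisms from quotients of `H`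
(`card_iso_mem_countSpan`). Averaging leaves the sum over `f` unchanged because Aut H permutes the
homomorphisms `G → H` by composition (`card_hom_iso`). So hom(G, H₁) mod `p` is a fixed linear
combination of values hom(glue J G v, H), with gadgets `J` and coefficients that depend on `H`, `H₁`
and `p` only (`exists_gadgets`). For arbitrary `G` the count is the product over the components of
`G`.

The rest turns this into a polynomial time oracle machine. Programs in a small stack language
compile to oracle machines (`Exec.outputsWithin`). `TuringReducesTo.of_solves` replaces each query
of a given reduction to `H₁` by a run of a program that uses the oracle for `H`. That program,
`solver`, splits off one component at a time by a search from its first vertex, queries the finitely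
many glued graphs, and multiplies an accumulator in `ZMod p`. -/

/-! ### Structured programs on stacks and their semantics. -/

/-- A structured programming language on stacks: `pop` branches on the top symbol of a stack,
`loop k body` pops the stack `k` until it is empty and executes `body a` for each symbol `a`
found there, and `query` consults the oracle. -/
inductive Prog (ι : Type) (A : ι → Type) : Type
  | skip : Prog ι A
  | push (k : ι) (a : A k) : Prog ι A
  | pop (k : ι) (e : Prog ι A) (f : A k → Prog ι A) : Prog ι A
  | seq (P Q : Prog ι A) : Prog ι A
  | loop (k : ι) (body : A k → Prog ι A) : Prog ι A
  | query : Prog ι A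

namespace Prog

variable {ι : Type} {A : ι → Type}

/-- Big-step semantics: `Exec O P S S' t` says that `P` transforms the store `S` into `S'` in `t`
steps, where `O` is the effect of a query on the store. -/
inductive Exec [DecidableEq ι] (O : (∀ k, List (A k)) → Option (∀ k, List (A k))) :
    Prog ι A → (∀ k, List (A k)) → (∀ k, List (A k)) → ℕ → Prop
  | skip (S) : Exec O skip S S 0
  | push (k a S) : Exec O (push k a) S (Function.update S k (a :: S k)) 1
  | pop_nil {k e f S S' t} : S k = [] → Exec O e S S' t → Exec O (pop k e f) S S' (t + 1)
  | pop_cons {k e f S S' t a l} : S k = a :: l → Exec O (f a) (Function.update S k l) S' t →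
      Exec O (pop k e f) S S' (t + 1)
  | seq {P Q S S₁ S' t₁ t₂} : Exec O P S S₁ t₁ → Exec O Q S₁ S' t₂ →
      Exec O (seq P Q) S S' (t₁ + t₂)
  | loop_nil {k body S} : S k = [] → Exec O (loop k body) S S 1
  | loop_cons {k body S S₁ S' t₁ t₂ a l} : S k = a :: l →
      Exec O (body a) (Function.update S k l) S₁ t₁ → Exec O (loop k body) S₁ S' t₂ →
      Exec O (loop k body) S S' (t₁ + t₂ + 1)
  | query {S S'} : O S = some S' → Exec O query S S' 1

/-! ### Compilation of structured programs to oracle machines. -/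

/-- The program points of a program. -/
def Lab : Prog ι A → Type
  | skip => Empty
  | push _ _ => Unit
  | pop _ e f => Option (Lab e ⊕ Σ a, Lab (f a))
  | seq P Q => Lab P ⊕ Lab Q
  | loop _ body => Option (Σ a, Lab (body a))
  | query => Unit

instance finite_lab [∀ k, Finite (A k)] : (P : Prog ι A) → Finite (Lab P)
  | skip => inferInstanceAs (Finite Empty)
  | push _ _ => inferInstanceAs (Finite Unit)
  | pop _ e f =>
    have := finite_lab e
    have := fun a => finite_lab (f a)
    inferInstanceAs (Finite (Option (Lab e ⊕ Σ a, Lab (f a))))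
  | seq P Q =>
    have := finite_lab P
    have := finite_lab Q
    inferInstanceAs (Finite (Lab P ⊕ Lab Q))
  | loop _ body =>
    have := fun a => finite_lab (body a)
    inferInstanceAs (Finite (Option (Σ a, Lab (body a))))
  | query => inferInstanceAs (Finite Unit)

/-- Instructions with jumps to labels in `L`. -/
inductive Instr (ι : Type) (A : ι → Type) (L : Type) : Type
  | push (k : ι) (a : A k) (n : L)
  | pop (k : ι) (e : L) (f : A k → L)
  | query (n : L)

/-- The label at which the execution of a program starts, when its program points are embedded in
`L` by `em` and `x` is the label to go to in the end. -/
def entry {L : Type} : (P : Prog ι A) → L → (Lab P → L) → L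
  | skip, x, _ => x
  | push _ _, _, em => em ()
  | pop _ _ _, _, em => em none
  | seq P Q, x, em => entry P (entry Q x (em ∘ Sum.inr)) (em ∘ Sum.inl)
  | loop _ _, _, em => em none
  | query, _, em => em ()

/-- The instruction at each program point. -/
def code {L : Type} : (P : Prog ι A) → L → (Lab P → L) → Lab P → Instr ι A L
  | push k a, x, _, _ => .push k a x
  | pop k e f, x, em, none =>
    .pop k (entry e x (em ∘ some ∘ Sum.inl)) fun a => entry (f a) x fun l => em (some (.inr ⟨a, l⟩))
  | pop _ e _, x, em, some (.inl l) => code e x (em ∘ some ∘ Sum.inl) l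
  | pop _ _ f, x, em, some (.inr ⟨a, l⟩) => code (f a) x (fun l => em (some (.inr ⟨a, l⟩))) l
  | seq P Q, x, em, .inl l => code P (entry Q x (em ∘ Sum.inr)) (em ∘ Sum.inl) l
  | seq _ Q, x, em, .inr l => code Q x (em ∘ Sum.inr) l
  | loop k body, x, em, none =>
    .pop k x fun a => entry (body a) (em none) fun l => em (some ⟨a, l⟩)
  | loop _ body, _, em, some ⟨a, l⟩ => code (body a) (em none) (fun l => em (some ⟨a, l⟩)) l
  | query, x, _, _ => .query x

end Prog

namespace Prog

variable {K : Type} {Γ : K → Type}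

/-- The statement of `Turing.TM2` that carries out an instruction. The internal memory holds the
symbol popped last. -/
def Instr.toStmt {L : Type} [DecidableEq K] :
    Instr (Port ⊕ K) (stackAlphabet Γ) L →
      Turing.TM2.Stmt (stackAlphabet Γ) L (Option (Σ k, stackAlphabet Γ k))
  | .push k a n => .push k (fun _ => a) (.goto fun _ => n)
  | .pop k e f => .pop k (fun _ o => o.map (Sigma.mk k)) (.goto fun
    | none => e
    | some ⟨k', a⟩ => if h : k' = k then f (h ▸ a) else e)
  | .query n => .goto fun _ => n

/-- The successor label of a query instruction. -/
def Instr.next {L : Type} {ι : Type} {A : ι → Type} : Instr ι A L → Option L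
  | .query n => some n
  | _ => none

/-- The oracle machine that executes a program. -/
def machine [DecidableEq K] [Finite K] [∀ k, Finite (Γ k)]
    (P : Prog (Port ⊕ K) (stackAlphabet Γ)) : OracleMachine :=
  have _ : ∀ k : Port ⊕ K, Finite (stackAlphabet Γ k) := fun
    | .inl _ => inferInstanceAs (Finite Bool)
    | .inr k => inferInstanceAs (Finite (Γ k))
  { K := K
    Γ := Γ
    Λ := Option (Lab P)
    σ := Option (Σ k, stackAlphabet Γ k)
    start := entry P none some
    initialState := none
    program := fun
      | none => .halt
      | some l => (code P none some l).toStmt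
    resume := fun
      | none => none
      | some l => (code P none some l).next }

/-- The effect of a query to the oracle `O` on the store. -/
def oracleStep [DecidableEq K] (O : List Bool → Option (List Bool))
    (S : ∀ k, List (stackAlphabet Γ k)) : Option (∀ k, List (stackAlphabet Γ k)) :=
  (O (S (.inl .query))).map fun a =>
    Function.update (Function.update S (.inl .query) []) (.inl .answer) a

theorem stepAux_pop_nil [DecidableEq K] {L : Type} {k : Port ⊕ K} {e : L} {f : stackAlphabet Γ k → L} {v S}
    (hS : S k = []) :
    Turing.TM2.stepAux (Instr.pop k e f).toStmt v S = ⟨some e, none, S⟩ := by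
  simp only [Instr.toStmt, Turing.TM2.stepAux, hS, List.head?_nil, Option.map_none, List.tail_nil]
  rw [Function.update_eq_iff.2 ⟨hS.symm, fun _ _ => rfl⟩]

theorem stepAux_pop_cons [DecidableEq K] {L : Type} {k : Port ⊕ K} {e : L} {f : stackAlphabet Γ k → L} {v S a s}
    (hS : S k = a :: s) :
    Turing.TM2.stepAux (Instr.pop k e f).toStmt v S =
      ⟨some (f a), some ⟨k, a⟩, Function.update S k s⟩ := by
  simp [Instr.toStmt, Turing.TM2.stepAux, hS]

section simulation

variable [DecidableEq K] [Finite K] [∀ k, Finite (Γ k)] (P₀ : Prog (Port ⊕ K) (stackAlphabet Γ))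
  (O : List Bool → Option (List Bool))

/-- `P₀.Reaches O l S l' S' t`: the machine for `P₀` gets from the label `l` and the store `S` to
the label `l'` and the store `S'` in `t` steps, whatever its internal memory. -/
def Reaches (l : Option (Lab P₀)) (S : ∀ k, List (stackAlphabet Γ k))
    (l' : Option (Lab P₀)) (S' : ∀ k, List (stackAlphabet Γ k)) (t : ℕ) : Prop :=
  ∀ v, ∃ v', (flip bind ((machine P₀).step O))^[t] (some ⟨some l, v, S⟩) = some ⟨some l', v', S'⟩

variable {P₀ O}

theorem Reaches.trans {l₁ l₂ l₃ S₁ S₂ S₃ t₁ t₂} (h₁ : P₀.Reaches O l₁ S₁ l₂ S₂ t₁)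
    (h₂ : P₀.Reaches O l₂ S₂ l₃ S₃ t₂) : P₀.Reaches O l₁ S₁ l₃ S₃ (t₁ + t₂) := by
  intro v
  obtain ⟨v₁, e₁⟩ := h₁ v
  obtain ⟨v₂, e₂⟩ := h₂ v₁
  exact ⟨v₂, by rw [add_comm, Function.iterate_add_apply, e₁, e₂]⟩

theorem reaches_push {l : Lab P₀} {k a n} (h : code P₀ none some l = .push k a n) (S) :
    P₀.Reaches O (some l) S n (Function.update S k (a :: S k)) 1 := by
  intro v
  refine ⟨v, ?_⟩
  simp [flip, OracleMachine.step, machine, h, Instr.next, Instr.toStmt]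
  rfl

theorem reaches_pop_nil {l : Lab P₀} {k e f} (h : code P₀ none some l = .pop k e f) {S}
    (hS : S k = []) : P₀.Reaches O (some l) S e S 1 := by
  intro v
  refine ⟨none, ?_⟩
  simp only [Function.iterate_one, flip, Option.bind_eq_bind, Option.bind_some,
    OracleMachine.step, machine, h, Instr.next]
  exact congrArg some (stepAux_pop_nil hS)

theorem reaches_pop_cons {l : Lab P₀} {k e f} (h : code P₀ none some l = .pop k e f) {S a s}
    (hS : S k = a :: s) : P₀.Reaches O (some l) S (f a) (Function.update S k s) 1 := by
  intro v
  refine ⟨some ⟨k, a⟩, ?_⟩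
  simp only [Function.iterate_one, flip, Option.bind_eq_bind, Option.bind_some,
    OracleMachine.step, machine, h, Instr.next]
  exact congrArg some (stepAux_pop_cons hS)

theorem reaches_query {l : Lab P₀} {n} (h : code P₀ none some l = .query n) {S S'}
    (hS : oracleStep O S = some S') : P₀.Reaches O (some l) S n S' 1 := by
  intro v
  refine ⟨v, ?_⟩
  obtain ⟨a, ha, rfl⟩ := Option.map_eq_some_iff.1 hS
  simp [flip, OracleMachine.step, machine, h, Instr.next, ha]

/-- Induction on the execution. The exit label `x` and the embedding `em` of program points vary,
because a subprogram sits at its own place in `P₀` with its own continuation. For a loop body the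
continuation is the label of the loop itself. -/
theorem Exec.reaches {P : Prog (Port ⊕ K) (stackAlphabet Γ)} {S S' t}
    (h : Exec (oracleStep O) P S S' t) :
    ∀ (x : Option (Lab P₀)) (em : Lab P → Option (Lab P₀)),
      (∀ l, ∃ l₀, em l = some l₀ ∧ code P₀ none some l₀ = code P x em l) →
        P₀.Reaches O (entry P x em) S x S' t := by
  induction h with
  | skip S => exact fun x em _ v => ⟨v, rfl⟩
  | push k a S =>
    intro x em hc
    obtain ⟨l₀, e, h⟩ := hc ()
    rw [entry, e]
    exact reaches_push h S
  | pop_nil hS _ ih =>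
    intro x em hc
    obtain ⟨l₀, e, h⟩ := hc none
    rw [entry, e, add_comm]
    exact (reaches_pop_nil h hS).trans (ih x _ fun l => hc (some (.inl l)))
  | @pop_cons k _ _ _ _ _ a _ hS _ ih =>
    intro x em hc
    obtain ⟨l₀, e, h⟩ := hc none
    rw [entry, e, add_comm]
    exact (reaches_pop_cons h hS).trans (ih x _ fun l => hc (some (.inr ⟨a, l⟩)))
  | seq _ _ ih₁ ih₂ =>
    intro x em hc
    exact (ih₁ _ _ fun l => hc (.inl l)).trans (ih₂ x _ fun l => hc (.inr l))
  | loop_nil hS =>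
    intro x em hc
    obtain ⟨l₀, e, h⟩ := hc none
    rw [entry, e]
    exact reaches_pop_nil h hS
  | @loop_cons k body _ _ _ _ _ a _ hS _ _ ih₁ ih₂ =>
    intro x em hc
    obtain ⟨l₀, e, h⟩ := hc none
    rw [add_comm]
    have h₁ := ih₁ (em none) (fun l => em (some ⟨a, l⟩)) fun l => hc (some ⟨a, l⟩)
    have h₂ := ih₂ x em hc
    have h₀ := reaches_pop_cons (O := O) h hS
    rw [← e] at h₀
    exact h₀.trans (h₁.trans h₂)
  | query hS =>
    intro x em hc
    obtain ⟨l₀, e, h⟩ := hc ()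
    rw [entry, e]
    exact reaches_query h hS

/-- A program that turns the input `w` into the output `y` gives a machine that does so. -/
theorem Exec.outputsWithin {w y : List Bool} {S' t B}
    (h : Exec (oracleStep O) P₀ (Function.update (fun _ => []) (.inl .input) w) S' t)
    (hy : S' (.inl .output) = y) (hB : t + 1 ≤ B) :
    (machine P₀).OutputsWithin O w y B := by
  obtain ⟨v', hv⟩ := h.reaches (P₀ := P₀) none some (fun l => ⟨l, rfl, rfl⟩) none
  -- The additional step executes `halt` at the final label `none`.
  refine ⟨⟨none, v', S'⟩, ⟨⟨⟨t + 1, ?_⟩, hB⟩⟩, rfl, hy⟩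
  have e : (machine P₀).init w = ⟨some (entry P₀ none some), none,
      Function.update (fun _ => []) (.inl .input) w⟩ := by
    unfold OracleMachine.init
    congr 1
    funext k
    rcases k with (_ | _ | _ | _) | k <;> rfl
  rw [e, add_comm, Function.iterate_add_apply]
  refine (congrArg _ hv).trans ?_
  simp [flip, OracleMachine.step, machine]
  rfl

end simulation

end Prog

/-! ### Programs acting on part of a larger family of stacks. -/

/-- An embedding of a family of stacks into another one. -/
structure StackEmb {ι ι' : Type} (A : ι → Type) (A' : ι' → Type) where
  toFun : ι → ι'
  injective : Function.Injective toFun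
  symb : ∀ k, A k ≃ A' (toFun k)

namespace StackEmb

variable {ι ι' : Type} {A : ι → Type} {A' : ι' → Type} (E : StackEmb A A')

/-- The stacks of `T` that belong to the embedded family have the contents `S`. -/
def Sees (T : ∀ j, List (A' j)) (S : ∀ k, List (A k)) : Prop :=
  ∀ k, T (E.toFun k) = (S k).map (E.symb k)

/-- `T` and `T'` agree outside the embedded family. -/
def Frame (T T' : ∀ j, List (A' j)) : Prop :=
  ∀ j, j ∉ Set.range E.toFun → T' j = T j

variable {E}

theorem Sees.update [DecidableEq ι] [DecidableEq ι'] {T S} (h : E.Sees T S) (k) {x y}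
    (hx : x = y.map (E.symb k)) :
    E.Sees (Function.update T (E.toFun k) x) (Function.update S k y) := by
  intro k'
  by_cases hk : k' = k
  · subst hk
    simp [hx]
  · rw [Function.update_of_ne (E.injective.ne hk), Function.update_of_ne hk, h]

theorem Frame.update [DecidableEq ι'] (T) (k) (x) :
    E.Frame T (Function.update T (E.toFun k) x) :=
  fun _ hj => Function.update_of_ne (fun e => hj ⟨k, e.symm⟩) _ _

theorem Frame.refl (T) : E.Frame T T := fun _ _ => rfl

theorem Frame.trans {T₁ T₂ T₃} (h₁ : E.Frame T₁ T₂) (h₂ : E.Frame T₂ T₃) : E.Frame T₁ T₃ :=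
  fun j hj => (h₂ j hj).trans (h₁ j hj)

theorem Sees.update_of_notMem [DecidableEq ι'] {T S} (h : E.Sees T S) {j}
    (hj : j ∉ Set.range E.toFun) (x) : E.Sees (Function.update T j x) S := by
  intro k
  rw [Function.update_of_ne (fun e => hj ⟨k, e⟩), h]

theorem Sees.nil {T S k} (h : E.Sees T S) (hk : S k = []) : T (E.toFun k) = [] := by
  rw [h, hk, List.map_nil]

theorem Sees.cons {T S k a l} (h : E.Sees T S) (hk : S k = a :: l) :
    T (E.toFun k) = E.symb k a :: l.map (E.symb k) := by
  rw [h, hk, List.map_cons]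

end StackEmb

namespace Prog

section map

variable {ι ι' : Type} {A : ι → Type} {A' : ι' → Type}

/-- The program `P` acting on an embedded family of stacks. -/
def map (E : StackEmb A A') : Prog ι A → Prog ι' A'
  | skip => skip
  | push k a => push (E.toFun k) (E.symb k a)
  | pop k e f => pop (E.toFun k) (map E e) fun b => map E (f ((E.symb k).symm b))
  | seq P Q => seq (map E P) (map E Q)
  | loop k body => loop (E.toFun k) fun b => map E (body ((E.symb k).symm b))
  | query => query

/-- Each instruction touches embedded stacks only, so the execution can be copied step by step, in
the same time. Only the oracle may act beyond them, and `hO` demands that it acts compatibly. -/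
theorem Exec.map [DecidableEq ι] [DecidableEq ι'] {E : StackEmb A A'} {O O'}
    (hO : ∀ S S' T, O S = some S' → E.Sees T S →
      ∃ T', O' T = some T' ∧ E.Sees T' S' ∧ E.Frame T T')
    {P S S' t} (h : Exec O P S S' t) :
    ∀ {T}, E.Sees T S → ∃ T', Exec O' (P.map E) T T' t ∧ E.Sees T' S' ∧ E.Frame T T' := by
  induction h with
  | skip S => exact fun hT => ⟨_, .skip _, hT, .refl _⟩
  | push k a S =>
    exact fun hT => ⟨_, .push _ _ _, hT.update k (by rw [hT, List.map_cons]), .update _ _ _⟩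
  | pop_nil hS _ ih =>
    intro T hT
    obtain ⟨T', h₁, h₂, h₃⟩ := ih hT
    exact ⟨T', .pop_nil (hT.nil hS) h₁, h₂, h₃⟩
  | pop_cons hS _ ih =>
    intro T hT
    obtain ⟨T', h₁, h₂, h₃⟩ := ih (hT.update _ rfl)
    exact ⟨T', .pop_cons (hT.cons hS) (by simpa using h₁), h₂, .trans (.update _ _ _) h₃⟩
  | seq _ _ ih₁ ih₂ =>
    intro T hT
    obtain ⟨T₁, h₁, h₂, h₃⟩ := ih₁ hT
    obtain ⟨T₂, k₁, k₂, k₃⟩ := ih₂ h₂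
    exact ⟨T₂, .seq h₁ k₁, k₂, h₃.trans k₃⟩
  | loop_nil hS => exact fun hT => ⟨_, .loop_nil (hT.nil hS), hT, .refl _⟩
  | loop_cons hS _ _ ih₁ ih₂ =>
    intro T hT
    obtain ⟨T₁, h₁, h₂, h₃⟩ := ih₁ (hT.update _ rfl)
    obtain ⟨T₂, k₁, k₂, k₃⟩ := ih₂ h₂
    exact ⟨T₂, .loop_cons (hT.cons hS) (by simpa using h₁) k₁, k₂,
      .trans (.update _ _ _) (h₃.trans k₃)⟩
  | query hS =>
    intro T hT
    obtain ⟨T', h₁, h₂, h₃⟩ := hO _ _ _ hS hT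
    exact ⟨T', .query h₁, h₂, h₃⟩

end map

/-! ### Statements of `Turing.TM2` as programs. -/

section translation

variable {ι ι' Λ σ : Type} {A : ι → Type} {A' : ι' → Type} (E : StackEmb A A') (ctl : ι')
  (enc : Λ × σ → A' ctl)

/-- The program that carries out a statement of `Turing.TM2` with internal memory `v`, and then
pushes the next label and the next internal memory on the stack `ctl`. -/
def ofStmt : Turing.TM2.Stmt A Λ σ → σ → Prog ι' A'
  | .push k f q, v => seq (push (E.toFun k) (E.symb k (f v))) (ofStmt q v)
  | .peek k f q, v => pop (E.toFun k) (ofStmt q (f v none)) fun b =>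
      seq (push (E.toFun k) b) (ofStmt q (f v (some ((E.symb k).symm b))))
  | .pop k f q, v => pop (E.toFun k) (ofStmt q (f v none)) fun b =>
      ofStmt q (f v (some ((E.symb k).symm b)))
  | .load a q, v => ofStmt q (a v)
  | .branch f q₁ q₂, v => if f v then ofStmt q₁ v else ofStmt q₂ v
  | .goto l, v => push ctl (enc (l v, v))
  | .halt, _ => skip

/-- A bound for the number of steps that `ofStmt` takes. -/
def stmtCost : Turing.TM2.Stmt A Λ σ → ℕ
  | .push _ _ q => stmtCost q + 2
  | .peek _ _ q => stmtCost q + 2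
  | .pop _ _ q => stmtCost q + 2
  | .load _ q => stmtCost q
  | .branch _ q₁ q₂ => stmtCost q₁ + stmtCost q₂
  | .goto _ => 1
  | .halt => 0

/-- The content of the control stack that stands for a label and an internal memory. -/
def ctlList : Option Λ → σ → List (A' ctl)
  | none, _ => []
  | some l, v => [enc (l, v)]

variable {E ctl}

/-- The internal memory is a parameter of the translation, so `load` costs nothing and `branch` is
decided when the program is built. The bound on the growth of the stacks is what later keeps the
queries polynomially long. -/
theorem exec_ofStmt [DecidableEq ι] [DecidableEq ι'] (hctl : ctl ∉ Set.range E.toFun) {O}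
    (q : Turing.TM2.Stmt A Λ σ) : ∀ (v : σ) {S T}, E.Sees T S → T ctl = [] →
      ∃ T' t, Exec O (ofStmt E ctl enc q v) T T' t ∧ t ≤ stmtCost q ∧
        E.Sees T' (Turing.TM2.stepAux q v S).stk ∧
        T' ctl = ctlList ctl enc (Turing.TM2.stepAux q v S).l (Turing.TM2.stepAux q v S).var ∧
        (∀ j, j ∉ Set.range E.toFun → j ≠ ctl → T' j = T j) ∧
        ∀ k, ((Turing.TM2.stepAux q v S).stk k).length ≤ (S k).length + stmtCost q := by
  have hc : ∀ k, ctl ≠ E.toFun k := fun k e => hctl ⟨k, e.symm⟩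
  induction q with
  | push k f q ih =>
    intro v S T hT h0
    obtain ⟨T', t, h₁, h₂, h₃, h₄, h₅, h₆⟩ := ih v
      (hT.update k (x := E.symb k (f v) :: T (E.toFun k)) (y := f v :: S k) (by simp [hT k]))
      (by rwa [Function.update_of_ne (hc k)])
    refine ⟨T', 1 + t, .seq (.push ..) h₁, by simp only [stmtCost]; omega, h₃, h₄,
      fun j hj hj' => (h₅ j hj hj').trans (StackEmb.Frame.update _ _ _ j hj), fun k' => ?_⟩
    have := h₆ k'
    simp only [Turing.TM2.stepAux, stmtCost]
    by_cases e : k' = k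
    · subst e
      simp only [Function.update_self, List.length_cons] at this
      omega
    · rw [Function.update_of_ne e] at this
      omega
  | peek k f q ih =>
    intro v S T hT h0
    rcases hS : S k with _ | ⟨a, l⟩
    · obtain ⟨T', t, h₁, h₂, h₃, h₄, h₅, h₆⟩ := ih (f v none) hT h0
      simp only [Turing.TM2.stepAux, hS, List.head?_nil, stmtCost]
      exact ⟨T', t + 1, .pop_nil (hT.nil hS) h₁, by omega, h₃, h₄, h₅,
        fun k' => (h₆ k').trans (by omega)⟩
    · obtain ⟨T', t, h₁, h₂, h₃, h₄, h₅, h₆⟩ := ih (f v (some a)) hT h0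
      simp only [Turing.TM2.stepAux, hS, List.head?_cons, stmtCost]
      refine ⟨T', 1 + t + 1, .pop_cons (hT.cons hS) (.seq (.push ..) ?_), by omega, h₃, h₄, h₅,
        fun k' => (h₆ k').trans (by omega)⟩
      rw [Function.update_self, Function.update_idem, ← hT.cons hS, Function.update_eq_self]
      simpa using h₁
  | pop k f q ih =>
    intro v S T hT h0
    rcases hS : S k with _ | ⟨a, l⟩
    · obtain ⟨T', t, h₁, h₂, h₃, h₄, h₅, h₆⟩ := ih (f v none) hT h0
      simp only [Turing.TM2.stepAux, hS, List.head?_nil, stmtCost, List.tail_nil]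
      rw [Function.update_eq_iff.2 ⟨hS.symm, fun _ _ => rfl⟩]
      exact ⟨T', t + 1, .pop_nil (hT.nil hS) h₁, by omega, h₃, h₄, h₅,
        fun k' => (h₆ k').trans (by omega)⟩
    · obtain ⟨T', t, h₁, h₂, h₃, h₄, h₅, h₆⟩ := ih (f v (some a))
        (hT.update k (x := l.map (E.symb k)) (y := l) rfl) (by rwa [Function.update_of_ne (hc k)])
      simp only [Turing.TM2.stepAux, hS, List.head?_cons, stmtCost, List.tail_cons]
      refine ⟨T', t + 1, .pop_cons (hT.cons hS) (by simpa using h₁), by omega, h₃, h₄,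
        fun j hj hj' => (h₅ j hj hj').trans (StackEmb.Frame.update _ _ _ j hj), fun k' => ?_⟩
      have := h₆ k'
      by_cases e : k' = k
      · subst e
        simp only [Function.update_self] at this
        simp only [hS, List.length_cons]
        omega
      · rw [Function.update_of_ne e] at this
        omega
  | load a q ih => exact fun v S T hT h0 => ih (a v) hT h0
  | branch f q₁ q₂ ih₁ ih₂ =>
    intro v S T hT h0
    simp only [Turing.TM2.stepAux, ofStmt, stmtCost]
    cases f v
    · obtain ⟨T', t, h₁, h₂, h₃, h₄, h₅, h₆⟩ := ih₂ v hT h0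
      exact ⟨T', t, h₁, by omega, h₃, h₄, h₅, fun k' => (h₆ k').trans (by simp)⟩
    · obtain ⟨T', t, h₁, h₂, h₃, h₄, h₅, h₆⟩ := ih₁ v hT h0
      exact ⟨T', t, h₁, by omega, h₃, h₄, h₅, fun k' => (h₆ k').trans (by simp [← add_assoc])⟩
  | goto l =>
    intro v S T hT h0
    refine ⟨_, 1, .push .., le_rfl, hT.update_of_notMem hctl _, ?_,
      fun j _ hj => Function.update_of_ne hj _ _, fun k => by simp⟩
    simp [h0, ctlList]
  | halt => exact fun v S T hT h0 => ⟨T, 0, .skip _, le_rfl, hT, h0, fun _ _ _ => rfl, fun k => by simp⟩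

end translation

end Prog

/-! ### Composition of a Turing reduction with a program that answers its queries. -/

namespace CountingProblem

/-- The effect of a query to the oracle `O` on a store that holds bits only. -/
def queryStep {W : Type} [DecidableEq W] (O : List Bool → Option (List Bool))
    (S : Port ⊕ W → List Bool) : Option (Port ⊕ W → List Bool) :=
  (O (S (.inl .query))).map fun a =>
    Function.update (Function.update S (.inl .query) []) (.inl .answer) a

/-- The program `P` computes the answers to the queries to `Q₁`, using the oracle `Q₂`, in time
`B N`, where `N` bounds the length of the query and the length of the previous answer. -/
def Solves {W : Type} [DecidableEq W] (P : Prog (Port ⊕ W) fun _ => Bool)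
    (Q₁ Q₂ : CountingProblem) (B : ℕ → ℕ) : Prop :=
  ∀ (x : Q₁.Instance) (S : Port ⊕ W → List Bool) (N : ℕ), S (.inl .query) = Q₁.encode x →
    (Q₁.encode x).length ≤ N → (S (.inl .answer)).length ≤ N → (∀ w, S (.inr w) = []) →
      ∃ t ≤ B N, Prog.Exec (queryStep Q₂.oracle) P S
        (Function.update (Function.update S (.inl .query) []) (.inl .answer)
          (Computability.encodeNat (Q₁.value x))) t

section composition

variable {M : OracleMachine} {W : Type}

/-- The alphabets of the work stacks of the composed machine. -/
abbrev compAlphabet (M : OracleMachine) (W : Type) : M.K ⊕ Option W → Type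
  | .inl k => M.Γ k
  | .inr none => M.Λ × M.σ
  | .inr (some _) => Bool

variable (M W) in
/-- The stacks of the simulated machine. -/
def simEmb : StackEmb (stackAlphabet M.Γ) (stackAlphabet (compAlphabet M W)) where
  toFun
    | .inl i => .inl i
    | .inr k => .inr (.inl k)
  injective := by rintro (i | k) (j | l) h <;> simp_all
  symb
    | .inl _ => Equiv.refl Bool
    | .inr k => Equiv.refl (M.Γ k)

variable (M W) in
/-- The stacks of the program that answers the queries. -/
def solverEmb : StackEmb (fun _ : Port ⊕ W => Bool) (stackAlphabet (compAlphabet M W)) where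
  toFun
    | .inl i => .inl i
    | .inr w => .inr (.inr (some w))
  injective := by rintro (i | k) (j | l) h <;> simp_all
  symb
    | .inl _ => Equiv.refl Bool
    | .inr _ => Equiv.refl Bool

/-- The control stack of the composed machine. -/
abbrev simCtl (M : OracleMachine) (W : Type) : Port ⊕ (M.K ⊕ Option W) := .inr (.inr none)

/-- One step of the simulated machine. -/
def simStep (P : Prog (Port ⊕ W) fun _ => Bool) (s : M.Λ × M.σ) :
    Prog (Port ⊕ (M.K ⊕ Option W)) (stackAlphabet (compAlphabet M W)) :=
  match M.resume s.1 with
  | none => Prog.ofStmt (simEmb M W) (simCtl M W) id (M.program s.1) s.2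
  | some l' => .seq (P.map (solverEmb M W)) (.push (simCtl M W) (l', s.2))

theorem simCtl_notMem : simCtl M W ∉ Set.range (simEmb M W).toFun := by
  rintro ⟨i | k, h⟩ <;> simp [simEmb] at h

theorem solver_notMem (w : W) : .inr (.inr (some w)) ∉ Set.range (simEmb M W).toFun := by
  rintro ⟨i | k, h⟩ <;> simp [simEmb] at h

theorem sees_port {T S} (h : (simEmb M W).Sees T S) (i : Port) : T (.inl i) = S (.inl i) :=
  (h (.inl i)).trans (List.map_id _)

variable [DecidableEq W]

/-- The simulated machine and the solver share exactly the four ports. The solver finds its private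
stacks empty and leaves them empty, so it can be called again; the work stacks of the simulated
machine and the control stack lie outside its frame. -/
theorem exec_solver {P : Prog (Port ⊕ W) fun _ => Bool} {Q₁ Q₂ : CountingProblem} {B : ℕ → ℕ}
    (hP : Solves P Q₁ Q₂ B) {x : Q₁.Instance} {S T} (hT : (simEmb M W).Sees T S)
    (hx : S (.inl .query) = Q₁.encode x) {N : ℕ} (hN : ∀ i, (S (.inl i)).length ≤ N)
    (hW : ∀ w, T (.inr (.inr (some w))) = []) :
    ∃ T', ∃ t ≤ B N,
      Prog.Exec (Prog.oracleStep Q₂.oracle) (P.map (solverEmb M W)) T T' t ∧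
      (simEmb M W).Sees T' (Function.update (Function.update S (.inl .query) []) (.inl .answer)
        (Computability.encodeNat (Q₁.value x))) ∧ T' (simCtl M W) = T (simCtl M W) ∧
      ∀ w, T' (.inr (.inr (some w))) = [] := by
  -- The store as the solver sees it.
  let S₀ : Port ⊕ W → List Bool := Sum.elim (fun i => S (.inl i)) fun _ => []
  have hS₀ : (solverEmb M W).Sees T S₀ := by
    rintro (i | w)
    · exact (sees_port hT i).trans (List.map_id _).symm
    · exact hW w
  obtain ⟨t, ht, he⟩ := hP x S₀ N hx (hx ▸ hN .query) (hN .answer) fun _ => rfl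
  obtain ⟨T', h₁, h₂, h₃⟩ := he.map (O' := Prog.oracleStep Q₂.oracle) (E := solverEmb M W) (by
    intro S S' T hS hT
    obtain ⟨a, ha, rfl⟩ := Option.map_eq_some_iff.1 hS
    refine ⟨_, Option.map_eq_some_iff.2 ⟨a, ?_, rfl⟩, ?_, ?_⟩
    · rw [← ha]
      exact congrArg _ ((hT (.inl .query)).trans (List.map_id _))
    · exact (hT.update (.inl .query) (x := []) (y := []) rfl).update (.inl .answer)
        (List.map_id a).symm
    · exact .trans (StackEmb.Frame.update (E := solverEmb M W) T (.inl .query) [])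
        (StackEmb.Frame.update (E := solverEmb M W) _ (.inl .answer) a)) hS₀
  refine ⟨T', t, ht, h₁, ?_, h₃ _ ?_, fun w => ?_⟩
  · rintro (i | k)
    · refine ((h₂ (.inl i)).trans (List.map_id _)).trans (.trans ?_ (List.map_id _).symm)
      cases i <;> rfl
    · refine (h₃ (.inr (.inl k)) ?_).trans (hT (.inr k))
      rintro ⟨i | w, h⟩ <;> simp [solverEmb] at h
  · rintro ⟨i | w, h⟩ <;> simp [solverEmb] at h
  · exact h₂ (.inr w)

/-- Each round of the loop pops the control stack, which holds the current label and memory, and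
carries out one step of `M`. The control stack stays empty once `M` halts, which ends the loop. No
stack grows by more than `D` in a step: this is `hprog` for ordinary steps and `hval` for answers,
which arrive in a single step. With `n` the number of steps left, `N` thus bounds all queries to
come. -/
theorem exec_sim {P : Prog (Port ⊕ W) fun _ => Bool} {Q₁ Q₂ : CountingProblem} {B : ℕ → ℕ}
    (hP : Solves P Q₁ Q₂ B) {D N : ℕ} (hprog : ∀ l, Prog.stmtCost (M.program l) ≤ D)
    (hval : ∀ x, (Computability.encodeNat (Q₁.value x)).length ≤ D) (n : ℕ) :
    ∀ (c c' : M.Cfg) (T), (flip bind (M.step Q₁.oracle))^[n] (some c) = some c' → c'.l = none →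
      (simEmb M W).Sees T c.stk → T (simCtl M W) = Prog.ctlList _ id c.l c.var →
      (∀ w, T (.inr (.inr (some w))) = []) → (∀ k, (c.stk k).length + D * n ≤ N) →
      ∃ T', ∃ t ≤ n * (D + B N + 2) + 1,
        Prog.Exec (Prog.oracleStep Q₂.oracle) (.loop (simCtl M W) (simStep P)) T T' t ∧
        (simEmb M W).Sees T' c'.stk := by
  induction n with
  | zero =>
    intro c c' T h hl hT hc _ _
    obtain rfl : c = c' := Option.some_injective _ h
    rw [hl] at hc
    exact ⟨T, 1, by simp, .loop_nil hc, hT⟩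
  | succ n ih =>
    intro c c' T h hl hT hc hW hN
    obtain ⟨l, v, S⟩ := c
    rw [Function.iterate_succ_apply] at h
    have hfix : ∀ n, (flip bind (M.step Q₁.oracle))^[n] none = none := fun n =>
      Function.iterate_fixed rfl n
    cases l with
    | none =>
      have : flip bind (M.step Q₁.oracle) (some ⟨none, v, S⟩) = none := rfl
      rw [this, hfix] at h
      exact absurd h (by simp)
    | some l =>
      have hmain : ∃ c₁ T₁, ∃ t₁ ≤ D + B N + 1, M.step Q₁.oracle ⟨some l, v, S⟩ = some c₁ ∧
          Prog.Exec (Prog.oracleStep Q₂.oracle) (simStep P (l, v))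
            (Function.update T (simCtl M W) []) T₁ t₁ ∧
          (simEmb M W).Sees T₁ c₁.stk ∧ T₁ (simCtl M W) = Prog.ctlList _ id c₁.l c₁.var ∧
          (∀ w, T₁ (.inr (.inr (some w))) = []) ∧ ∀ k, (c₁.stk k).length ≤ (S k).length + D := by
        have hT₀ := hT.update_of_notMem simCtl_notMem []
        have hW₀ : ∀ w, Function.update T (simCtl M W) [] (.inr (.inr (some w))) = [] := fun w => by
          rw [Function.update_of_ne (by simp [simCtl]), hW w]
        cases hr : M.resume l with
        | none =>
          obtain ⟨T₁, t₁, h₁, h₂, h₃, h₄, h₅, h₆⟩ := Prog.exec_ofStmt id simCtl_notMem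
            (O := Prog.oracleStep Q₂.oracle) (M.program l) v hT₀ (Function.update_self ..)
          refine ⟨_, T₁, t₁, ?_, by simp [OracleMachine.step, hr], ?_, h₃, h₄, fun w => ?_,
            fun k => (h₆ k).trans (Nat.add_le_add_left (hprog l) _)⟩
          · have := hprog l
            omega
          · simp only [simStep, hr]
            exact h₁
          · rw [h₅ _ (solver_notMem w) (by simp), hW₀]
        | some l' =>
          -- On an illegitimate query `M` would be stuck, and could not reach `c'`.
          have hq : (Q₁.oracle (S (.inl .query))).isSome := by
            by_contra hq
            rw [Option.not_isSome_iff_eq_none] at hq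
            have : flip bind (M.step Q₁.oracle) (some ⟨some l, v, S⟩) = none := by
              simp [flip, OracleMachine.step, hr, hq]
            rw [this, hfix] at h
            exact absurd h (by simp)
          obtain ⟨x, hx⟩ : ∃ x, Q₁.encode x = S (.inl .query) := by
            by_contra hx
            rw [oracle, dif_neg hx] at hq
            exact absurd hq (by simp)
          obtain ⟨T₁, t₁, h₁, h₂, h₃, h₄, h₅⟩ := exec_solver hP hT₀ hx.symm
            (N := N) (fun i => le_trans (Nat.le_add_right _ _) (hN (.inl i))) hW₀
          rw [Function.update_self] at h₄
          refine ⟨⟨some l', v, Function.update (Function.update S (.inl .query) []) (.inl .answer)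
            (Computability.encodeNat (Q₁.value x))⟩, Function.update T₁ (simCtl M W) [(l', v)], t₁ + 1, ?_, ?_, ?_, h₃.update_of_notMem simCtl_notMem _, ?_,
            fun w => ?_, fun k => ?_⟩
          · omega
          · simp only [OracleMachine.step, hr, ← hx, oracle_encode, Option.map_some]
          · simp only [simStep, hr]
            have h := Prog.Exec.push (O := Prog.oracleStep Q₂.oracle) (simCtl M W) (l', v) T₁
            rw [h₄] at h
            exact .seq h₂ h
          · rw [Function.update_self]
            rfl
          · rw [Function.update_of_ne (by simp [simCtl]), h₅]
          · dsimp only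
            by_cases ha : k = .inl .answer
            · subst ha
              simp only [Function.update_self]
              have := hval x
              omega
            · rw [Function.update_of_ne ha]
              by_cases hk : k = .inl .query
              · subst hk
                simp
              · rw [Function.update_of_ne hk]
                omega
      obtain ⟨c₁, T₁, t₁, ht₁, hs, he, hT₁, hc₁, hW₁, hlen⟩ := hmain
      have h' : (flip bind (M.step Q₁.oracle))^[n] (some c₁) = some c' := by
        rw [← h, ← hs]
        rfl
      obtain ⟨T', t, ht, h₁, h₂⟩ := ih c₁ c' T₁ h' hl hT₁ hc₁ hW₁ fun k => by
        have h1 := hlen k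
        have h2 := hN k
        simp only [Nat.mul_succ] at h2
        omega
      refine ⟨T', t₁ + t + 1, ?_, .loop_cons hc he h₁, h₂⟩
      rw [Nat.succ_mul]
      omega

/-- Turing reductions compose with programs that answer the queries in polynomial time. -/
theorem TuringReducesTo.of_solves {P₀ Q₁ Q₂ : CountingProblem} (h : P₀.TuringReducesTo Q₁)
    [Finite W] {P : Prog (Port ⊕ W) fun _ => Bool} (r : Polynomial ℕ)
    (hP : Solves P Q₁ Q₂ fun n => r.eval n) {D₀ : ℕ}
    (hval : ∀ x, (Computability.encodeNat (Q₁.value x)).length ≤ D₀) : P₀.TuringReducesTo Q₂ := by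
  obtain ⟨M, q, hM⟩ := h
  obtain ⟨D₁, hD₁⟩ := (Set.finite_range fun l => Prog.stmtCost (M.program l)).bddAbove
  let D := max D₀ D₁
  have : ∀ k, Finite (compAlphabet M W k) := by
    rintro (k | _ | w)
    · exact M.finiteΓ k
    · exact inferInstanceAs (Finite (M.Λ × M.σ))
    · exact inferInstanceAs (Finite Bool)
  -- Every stack of `M` holds at most the length of the input plus `D` symbols for each of the at
  -- most `q` steps.
  let N : Polynomial ℕ := Polynomial.X + Polynomial.C D * q
  -- The `3` pays for the initial push, the last test of the loop and the halting step.
  refine ⟨Prog.machine (Γ := compAlphabet M W) (.seq (.push (simCtl M W) (M.start, M.initialState))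
    (.loop (simCtl M W) (simStep P))), q * (Polynomial.C (D + 2) + r.comp N) + 3, fun x => ?_⟩
  obtain ⟨c', ⟨⟨⟨n, hn⟩, hnq⟩⟩, hl, ho⟩ := hM x
  dsimp only at hnq
  obtain ⟨T', t, ht, h₁, h₂⟩ := exec_sim (M := M) hP (D := D) (N := N.eval (P₀.encode x).length)
    (fun l => (hD₁ ⟨l, rfl⟩).trans (le_max_right _ _)) (fun x => (hval x).trans (le_max_left _ _))
    n (M.init (P₀.encode x)) c' (Function.update (Function.update (fun _ => [])
      (.inl .input) (P₀.encode x)) (simCtl M W) [(M.start, M.initialState)]) hn hl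
    (StackEmb.Sees.update_of_notMem (by
      rintro ((_ | _ | _ | _) | k)
      · exact (List.map_id _).symm
      all_goals rfl) simCtl_notMem _) (Function.update_self ..) (fun w => rfl) (fun k => by
      have : ((M.init (P₀.encode x)).stk k).length ≤ (P₀.encode x).length := by
        rcases k with (_ | _ | _ | _) | k <;> simp [OracleMachine.init]
      simp only [N, Polynomial.eval_add, Polynomial.eval_X, Polynomial.eval_mul, Polynomial.eval_C]
      exact Nat.add_le_add this (Nat.mul_le_mul_left D hnq))
  refine Prog.Exec.outputsWithin (.seq (.push ..) h₁) ((sees_port h₂ .output).trans ho) ?_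
  simp only [Polynomial.eval_add, Polynomial.eval_mul, Polynomial.eval_C, Polynomial.eval_comp,
    Polynomial.eval_ofNat]
  have := Nat.mul_le_mul_right (D + r.eval (N.eval (P₀.encode x).length) + 2) hnq
  rw [show D + 2 + r.eval (N.eval (P₀.encode x).length) =
    D + r.eval (N.eval (P₀.encode x).length) + 2 by omega]
  omega

end composition

end CountingProblem

/-! ### Gluing a rooted graph at a vertex. -/

namespace SimpleGraph

section glue

variable {U V W : Type*}

/-- The graph obtained from `G` by identifying the vertex `v` with the vertex `none` of `J`. -/
def glue (J : SimpleGraph (Option U)) (G : SimpleGraph V) (v : V) : SimpleGraph (U ⊕ V) where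
  Adj
    | .inl i, .inl j => J.Adj (some i) (some j)
    | .inr a, .inr b => G.Adj a b
    | .inl i, .inr a => a = v ∧ J.Adj (some i) none
    | .inr a, .inl i => a = v ∧ J.Adj (some i) none
  symm := ⟨by
    rintro (i | a) (j | b) h
    · exact J.symm.symm _ _ h
    · exact h
    · exact h
    · exact G.symm.symm _ _ h⟩
  loopless := ⟨by
    rintro (i | a) h
    · exact J.loopless.irrefl _ h
    · exact G.loopless.irrefl _ h⟩

/-- The number of homomorphisms from `J` to `H` that map `r` to `w`. -/
noncomputable def rootedCount (J : SimpleGraph U) (r : U) (H : SimpleGraph W) (w : W) : ℕ :=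
  Nat.card {b : J →g H // b r = w}

/-- A homomorphism from a glued graph is a pair of homomorphisms that agree on the common
vertex. -/
def glueHomEquiv (J : SimpleGraph (Option U)) (G : SimpleGraph V) (v : V) (H : SimpleGraph W) :
    (glue J G v →g H) ≃ Σ f : G →g H, {b : J →g H // b none = f v} where
  toFun g := ⟨⟨fun a => g (.inr a), fun {a b} h => g.map_rel (show (glue J G v).Adj _ _ from h)⟩,
    ⟨⟨fun o => o.elim (g (.inr v)) fun i => g (.inl i), by
      rintro (_ | i) (_ | j) h
      · exact absurd h (J.loopless.irrefl _)
      · exact g.map_rel (a := .inr v) (b := .inl j) ⟨rfl, J.symm.symm _ _ h⟩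
      · exact g.map_rel (a := .inl i) (b := .inr v) ⟨rfl, h⟩
      · exact g.map_rel (a := .inl i) (b := .inl j) h⟩, rfl⟩⟩
  invFun p := ⟨Sum.elim (fun i => p.2.1 (some i)) p.1, by
    obtain ⟨f, b, hb⟩ := p
    rintro (i | a) (j | a') h
    · exact b.map_rel h
    · obtain ⟨rfl, h⟩ := h
      have := b.map_rel h
      rwa [hb] at this
    · obtain ⟨rfl, h⟩ := h
      have := H.symm.symm _ _ (b.map_rel h)
      rwa [hb] at this
    · exact f.map_rel h⟩
  left_inv g := by
    ext (i | a) <;> rfl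
  right_inv := by
    rintro ⟨f, b, hb⟩
    have : ∀ b' : {b : J →g H // b none = f v}, (∀ o, b'.1 o = b o) →
      (⟨f, b'⟩ : Σ f : G →g H, {b : J →g H // b none = f v}) = ⟨f, b, hb⟩ := by
      rintro ⟨b', _⟩ h
      obtain rfl : b' = b := by
        ext o
        exact h o
      rfl
    refine this _ ?_
    rintro (_ | i)
    · exact hb.symm
    · rfl

theorem card_glue_hom [Finite U] [Finite W] (J : SimpleGraph (Option U)) (G : SimpleGraph V)
    (v : V) (H : SimpleGraph W) [Fintype (G →g H)] :
    Nat.card (glue J G v →g H) = ∑ f : G →g H, rootedCount J none H (f v) := by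
  rw [Nat.card_congr (glueHomEquiv J G v H), Nat.card_sigma]
  rfl

theorem rootedCount_congr {U' : Type*} {J : SimpleGraph U} {J' : SimpleGraph U'} (e : J ≃g J')
    (r : U) (H : SimpleGraph W) (w : W) : rootedCount J' (e r) H w = rootedCount J r H w := by
  refine Nat.card_congr ⟨fun b => ⟨b.1.comp e.toHom, b.2⟩,
    fun b => ⟨b.1.comp e.symm.toHom, by simpa using b.2⟩, fun b => ?_, fun b => ?_⟩
  · ext x
    simp
  · ext x
    simp

end glue

/-! ### Inclusion-exclusion: counts of automorphisms as combinations of rooted counts. -/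

section span

variable {W : Type*} (H : SimpleGraph W) (R : Type*) [CommRing R]

/-- The linear combinations of the functions that count, for each vertex `w` of `H`, the
homomorphisms from a fixed rooted graph to `H` that map the root to `w`. -/
noncomputable def countSpan : Submodule R (W → R) :=
  Submodule.span R (Set.range fun (J : Σ m, SimpleGraph (Option (Fin m))) (w : W) =>
    (rootedCount J.2 none H w : R))

variable {H R}

theorem rootedCount_mem_countSpan {U : Type*} [Finite U] (J : SimpleGraph U) (r : U) :
    (fun w => (rootedCount J r H w : R)) ∈ countSpan H R := by
  classical
  let e : U ≃ Option (Fin (Nat.card {u // u ≠ r})) :=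
    (Equiv.optionSubtypeNe r).symm.trans (Equiv.optionCongr (Finite.equivFin _))
  have he : e r = none := by simp [e]
  refine Submodule.subset_span ⟨⟨_, J.map e.toEmbedding⟩, ?_⟩
  funext w
  have := rootedCount_congr (Iso.map e J) r H w
  rw [← this]
  simp [he]

variable [Finite W]

/-- Homomorphisms that respect the identifications in `D` factor through the quotient of `H` by the
equivalence relation that `D` generates. If the quotient would have a loop, there are no such
homomorphisms and the function is zero. -/
theorem card_identifying_mem_countSpan (D : Set (W × W)) (h : W) :
    (fun w => (Nat.card {a : H →g H // a h = w ∧ ∀ e ∈ D, a e.1 = a e.2} : R)) ∈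
      countSpan H R := by
  let s : Setoid W := Relation.EqvGen.setoid fun x y => (x, y) ∈ D
  have hs : ∀ (f : W → W), (∀ e ∈ D, f e.1 = f e.2) → ∀ x y, s x y → f x = f y := by
    intro f hf x y hxy
    induction hxy with
    | rel x y h => exact hf _ h
    | refl x => rfl
    | symm x y _ ih => exact ih.symm
    | trans x y z _ _ ih₁ ih₂ => exact ih₁.trans ih₂
  by_cases hl : ∃ x y, H.Adj x y ∧ s x y
  · obtain ⟨x, y, hxy, hs'⟩ := hl
    have : ∀ w, IsEmpty {a : H →g H // a h = w ∧ ∀ e ∈ D, a e.1 = a e.2} := fun w =>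
      ⟨fun a => H.ne_of_adj (a.1.map_rel hxy) (hs a.1 a.2.2 x y hs')⟩
    simp only [Nat.card_of_isEmpty, Nat.cast_zero]
    exact Submodule.zero_mem _
  · push Not at hl
    let J : SimpleGraph (Quotient s) :=
      { Adj := fun x y => ∃ i j, Quotient.mk s i = x ∧ Quotient.mk s j = y ∧ H.Adj i j
        symm := ⟨fun _ _ ⟨i, j, hi, hj, hij⟩ => ⟨j, i, hj, hi, hij.symm⟩⟩
        loopless := ⟨fun _ ⟨i, j, hi, hj, hij⟩ => hl i j hij (Quotient.exact (hi.trans hj.symm))⟩ }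
    convert rootedCount_mem_countSpan (R := R) (H := H) J (Quotient.mk s h) using 3 with w
    refine Nat.card_congr ⟨fun a => ⟨⟨Quotient.lift a.1 fun x y hxy => hs a.1 a.2.2 x y hxy, ?_⟩,
      a.2.1⟩, fun b => ⟨⟨fun x => b.1 (Quotient.mk s x), fun {x y} hxy => b.1.map_rel
      ⟨x, y, rfl, rfl, hxy⟩⟩, b.2, fun e he => congrArg b.1 (Quotient.sound (.rel _ _ he))⟩,
      fun a => ?_, fun b => ?_⟩
    · rintro _ _ ⟨i, j, rfl, rfl, hij⟩
      exact a.1.map_rel hij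
    · ext x
      rfl
    · ext x
      induction x using Quotient.inductionOn
      rfl

-- Inclusion-exclusion over the set `D` of pairs of distinct vertices that are forced to have equal
-- images.
open Classical in
theorem card_injective_mem_countSpan (h : W) :
    (fun w => (Nat.card {a : H →g H // a h = w ∧ Function.Injective a} : R)) ∈ countSpan H R := by
  have := Fintype.ofFinite W
  have := Fintype.ofFinite (H →g H)
  have key : (fun w => (Nat.card {a : H →g H // a h = w ∧ Function.Injective a} : R)) =
      ∑ D ∈ (Finset.univ : Finset W).offDiag.powerset, (-1 : R) ^ D.card •
        fun w => (Nat.card {a : H →g H // a h = w ∧ ∀ e ∈ (D : Set (W × W)), a e.1 = a e.2} : R) := by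
    funext w
    have hc : ∀ q : (H →g H) → Prop, (Nat.card {a : H →g H // a h = w ∧ q a} : R) =
        ∑ a ∈ Finset.univ.filter (fun a : H →g H => a h = w), if q a then 1 else 0 := by
      intro q
      rw [Finset.sum_ite, Finset.sum_const_zero, add_zero, Finset.sum_const, nsmul_one,
        Finset.filter_filter, Nat.card_eq_fintype_card, Fintype.card_subtype]
    simp only [Finset.sum_apply, Pi.smul_apply, hc, smul_eq_mul, Finset.mul_sum]
    rw [Finset.sum_comm]
    refine Finset.sum_congr rfl fun a _ => ?_
    -- The indicator of injectivity is a product over the off-diagonal pairs; expanding it gives the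
    -- alternating sum over `D`.
    have h₁ : (if Function.Injective a then 1 else 0 : R) =
        ∏ e ∈ (Finset.univ : Finset W).offDiag, (1 - if a e.1 = a e.2 then 1 else 0) := by
      split_ifs with ha
      · refine (Finset.prod_eq_one fun e he => ?_).symm
        rw [if_neg fun h => (Finset.mem_offDiag.1 he).2.2 (ha h), sub_zero]
      · obtain ⟨x, y, hxy, hne⟩ : ∃ x y, a x = a y ∧ x ≠ y := by
          simpa [Function.Injective] using ha
        exact (Finset.prod_eq_zero (i := (x, y)) (by simpa using hne) (by simp [hxy])).symm
    refine .trans ?_ (h₁.trans ?_)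
    · congr
    · simp only [sub_eq_add_neg]
      rw [Finset.prod_one_add]
      refine Finset.sum_congr rfl fun D _ => ?_
      rw [Finset.prod_neg, Finset.prod_boole]
      simp
  rw [key]
  exact Submodule.sum_mem _ fun D _ =>
    Submodule.smul_mem _ _ (card_identifying_mem_countSpan (D : Set (W × W)) h)

/-- An injective endomorphism of a finite graph is an automorphism. -/
noncomputable def isoOfInjective (a : H →g H) (ha : Function.Injective a) : H ≃g H where
  toEquiv := Equiv.ofBijective a (Finite.injective_iff_bijective.1 ha)
  map_rel_iff' := by
    intro x y
    refine ⟨fun h => ?_, fun h => a.map_rel h⟩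
    -- The permutation `σ` has finite order, so its inverse is a power of `σ` and preserves
    -- adjacency as well.
    let σ : Equiv.Perm W := Equiv.ofBijective a (Finite.injective_iff_bijective.1 ha)
    have hσ : ∀ n x y, H.Adj x y → H.Adj ((σ ^ n) x) ((σ ^ n) y) := by
      intro n
      induction n with
      | zero => exact fun _ _ h => h
      | succ n ih => exact fun x y h => ih _ _ (a.map_rel h)
    obtain ⟨n, hn⟩ := Nat.exists_eq_succ_of_ne_zero (orderOf_pos σ).ne'
    have h1 : σ ^ n * σ = 1 := by rw [← pow_succ, ← Nat.succ_eq_add_one, ← hn, pow_orderOf_eq_one]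
    have h2 := hσ n _ _ h
    have h3 : ∀ z, (σ ^ n) (σ z) = z := fun z => by
      rw [← Equiv.Perm.mul_apply, h1, Equiv.Perm.one_apply]
    exact (h3 x) ▸ (h3 y) ▸ h2

theorem card_iso_mem_countSpan (h : W) :
    (fun w => (Nat.card {φ : H ≃g H // φ h = w} : R)) ∈ countSpan H R := by
  convert card_injective_mem_countSpan (R := R) (H := H) h using 3 with w
  refine Nat.card_congr ⟨fun φ => ⟨φ.1.toHom, φ.2, φ.1.injective⟩,
    fun a => ⟨isoOfInjective a.1 a.2.2, a.2.1⟩, fun φ => ?_, fun a => ?_⟩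
  · ext x
    rfl
  · ext x
    rfl

end span

instance finite_iso {W : Type*} [Finite W] (H : SimpleGraph W) : Finite (H ≃g H) :=
  Finite.of_injective (fun φ => (φ : W → W)) DFunLike.coe_injective

/-! ### Averaging over automorphisms: recovering the count for one component. -/

section connected

variable {V W : Type*} [Finite W] {G : SimpleGraph V} {H : SimpleGraph W}

/-- The bijection is (f, φ) ↦ (φ, φ⁻¹ ∘ f). This is the point where averaging over automorphisms is
undone. -/
theorem card_hom_iso (v : V) (h : W) [Fintype (G →g H)] :
    ∑ f : G →g H, Nat.card {φ : H ≃g H // φ h = f v} =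
      Nat.card (H ≃g H) * Nat.card {f : G →g H // f v = h} := by
  rw [← Nat.card_sigma, ← Nat.card_prod]
  refine Nat.card_congr ⟨fun p => ⟨p.2.1, p.2.1.symm.toHom.comp p.1, ?_⟩,
    fun p => ⟨p.1.toHom.comp p.2.1, p.1, ?_⟩, ?_, ?_⟩
  · obtain ⟨f, φ, hφ⟩ := p
    simp [← hφ]
  · simp [p.2.2]
  · rintro ⟨f, φ, hφ⟩
    have : ∀ (f' : G →g H) (h' : φ h = f' v), f' = f →
      (⟨f', φ, h'⟩ : Σ f : G →g H, {φ : H ≃g H // φ h = f v}) = ⟨f, φ, hφ⟩ := by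
      rintro f' h' rfl
      rfl
    refine this _ _ ?_
    ext x
    simp
  · rintro ⟨φ, f, hf⟩
    refine Prod.ext rfl (Subtype.ext ?_)
    ext x
    simp

/-- The homomorphisms from a connected graph to a component of `H` are the homomorphisms to `H`
that map a given vertex to that component. -/
def homComponentEquiv {v : V} (hv : ∀ u, G.Reachable v u) (C : H.ConnectedComponent) :
    (G →g C.toSimpleGraph) ≃ {f : G →g H // f v ∈ C.supp} where
  toFun f := ⟨C.toSimpleGraph_hom.comp f, (f v).2⟩
  invFun f := ⟨fun u => ⟨f.1 u, by
    have h := f.2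
    rw [ConnectedComponent.mem_supp_iff] at h
    change H.connectedComponentMk _ = C
    exact (ConnectedComponent.eq.2 ((hv u).map f.1)).symm.trans h⟩, fun {a b} h => f.1.map_rel h⟩
  left_inv f := by
    ext x
    rfl
  right_inv f := by
    ext x
    rfl

-- The gadgets and coefficients express the Aut H-average of the indicator of `C` as a combination
-- of rooted counts. They are chosen before `G` and `v`, so a machine can have them built in.
open Classical in
theorem exists_gadgets {p : ℕ} [hp : Fact p.Prime] (H : SimpleGraph W)
    (hH : ∀ φ : H ≃g H, orderOf φ ≠ p) (C : H.ConnectedComponent) :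
    ∃ l : List ((Σ m, SimpleGraph (Option (Fin m))) × ZMod p), ∀ (n : ℕ)
      (G : SimpleGraph (Fin n)) (v : Fin n), (∀ u, G.Reachable v u) →
        (Nat.card (G →g C.toSimpleGraph) : ZMod p) =
          (l.map fun J => J.2 * (Nat.card (glue J.1.2 G v →g H) : ZMod p)).sum := by
  have := Fintype.ofFinite W
  -- This function of `w` is the average over all automorphisms φ of the indicator of φ(C).
  have hF : (Nat.card (H ≃g H) : ZMod p)⁻¹ • ∑ h with h ∈ C.supp,
      (fun w => (Nat.card {φ : H ≃g H // φ h = w} : ZMod p)) ∈ countSpan H (ZMod p) :=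
    Submodule.smul_mem _ _ (Submodule.sum_mem _ fun h _ => card_iso_mem_countSpan h)
  obtain ⟨c, hc⟩ := Finsupp.mem_span_range_iff_exists_finsupp.1 hF
  refine ⟨c.support.toList.map fun J => (J, c J), fun n G v hv => ?_⟩
  have := Fintype.ofFinite (G →g H)
  -- Cauchy's theorem: a factor `p` of the group order would produce an automorphism of order `p`.
  have hcard : (Nat.card (H ≃g H) : ZMod p) ≠ 0 := by
    rw [Ne, ZMod.natCast_eq_zero_iff]
    intro hdvd
    obtain ⟨φ, hφ⟩ := exists_prime_orderOf_dvd_card' p hdvd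
    exact hH φ hφ
  -- The combination of the counts for glued graphs is the sum over all `f : G → H` of the averaged
  -- indicator at `f v`.
  have h₁ : ((c.support.toList.map fun J => (J, c J)).map
      fun J => J.2 * (Nat.card (glue J.1.2 G v →g H) : ZMod p)).sum =
      ∑ f : G →g H, (c.sum fun J a => a • fun w => (rootedCount J.2 none H w : ZMod p)) (f v) := by
    rw [List.map_map, Finset.sum_map_toList]
    simp only [Finsupp.sum, Finset.sum_apply, Pi.smul_apply, Function.comp_apply, smul_eq_mul]
    rw [Finset.sum_comm]
    refine Finset.sum_congr rfl fun J _ => ?_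
    rw [card_glue_hom, Nat.cast_sum, Finset.mul_sum]
  rw [h₁, hc]
  simp only [Pi.smul_apply, Finset.sum_apply, smul_eq_mul]
  rw [← Finset.mul_sum, Finset.sum_comm]
  have h₂ : ∀ h, ∑ f : G →g H, (Nat.card {φ : H ≃g H // φ h = f v} : ZMod p) =
      (Nat.card (H ≃g H) : ZMod p) * (Nat.card {f : G →g H // f v = h} : ZMod p) := fun h => by
    rw [← Nat.cast_sum, card_hom_iso, Nat.cast_mul]
  simp only [h₂]
  rw [← Finset.mul_sum, inv_mul_cancel_left₀ hcard, Nat.card_congr (homComponentEquiv hv C),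
    ← Nat.cast_sum]
  congr 1
  simp only [Nat.card_eq_fintype_card, Fintype.card_subtype]
  -- The homomorphisms with `f v` in `C` are sorted by the value `f v`.
  rw [Finset.card_eq_sum_card_fiberwise (f := fun f : G →g H => f v)
    (t := Finset.univ.filter (· ∈ C.supp)) (fun f hf => by simpa using hf)]
  refine Finset.sum_congr rfl fun h hh => ?_
  rw [Finset.filter_filter]
  congr 1
  ext f
  simp only [Finset.mem_filter, Finset.mem_univ, true_and] at hh ⊢
  exact ⟨fun h => h.2, fun h => ⟨h ▸ hh, h⟩⟩

end connected

end SimpleGraph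

/-! ### Registers and time bounds for concrete programs. -/

/-- The work stacks of the program that splits a graph into components. -/
inductive Reg
  -- Roles: `acc` the accumulated product; `n` and `A` the number (in unary) and adjacency matrix of
  -- the remaining vertices; `M` the search mask; `C` and `k` the matrix and vertex list of the
  -- current component; `B` the matrix of the rest under construction; `c` a counter; `t`, `R`, `T`
  -- scratch space.
  | acc | n | A | M | t | R | T | c | C | B | k
  deriving DecidableEq

instance : Fintype Reg where
  elems := {.acc, .n, .A, .M, .t, .R, .T, .c, .C, .B, .k}
  complete x := by cases x <;> decide

/-- The contents of all the stacks. -/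
structure Regs where
  (i o q a acc n A M t R T c C B k : List Bool)

namespace Regs

/-- The contents of the stacks as a store. -/
def fn (s : Regs) : Port ⊕ Reg → List Bool
  | .inl .input => s.i
  | .inl .output => s.o
  | .inl .query => s.q
  | .inl .answer => s.a
  | .inr .acc => s.acc
  | .inr .n => s.n
  | .inr .A => s.A
  | .inr .M => s.M
  | .inr .t => s.t
  | .inr .R => s.R
  | .inr .T => s.T
  | .inr .c => s.c
  | .inr .C => s.C
  | .inr .B => s.B
  | .inr .k => s.k

/-- Replace the content of one stack. -/
def set (s : Regs) : Port ⊕ Reg → List Bool → Regs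
  | .inl .input, l => { s with i := l }
  | .inl .output, l => { s with o := l }
  | .inl .query, l => { s with q := l }
  | .inl .answer, l => { s with a := l }
  | .inr .acc, l => { s with acc := l }
  | .inr .n, l => { s with n := l }
  | .inr .A, l => { s with A := l }
  | .inr .M, l => { s with M := l }
  | .inr .t, l => { s with t := l }
  | .inr .R, l => { s with R := l }
  | .inr .T, l => { s with T := l }
  | .inr .c, l => { s with c := l }
  | .inr .C, l => { s with C := l }
  | .inr .B, l => { s with B := l }
  | .inr .k, l => { s with k := l }

theorem set_fn (s : Regs) (k l) : (s.set k l).fn = Function.update s.fn k l := by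
  funext j
  rcases k with (_ | _ | _ | _) | (_ | _ | _ | _ | _ | _ | _ | _ | _ | _ | _) <;>
    rcases j with (_ | _ | _ | _) | (_ | _ | _ | _ | _ | _ | _ | _ | _ | _ | _) <;> rfl

theorem fn_set_self (s : Regs) (k l) : (s.set k l).fn k = l := by
  rw [set_fn, Function.update_self]

theorem fn_set_of_ne (s : Regs) {k k'} (h : k' ≠ k) (l) : (s.set k l).fn k' = s.fn k' := by
  rw [set_fn, Function.update_of_ne h]

theorem fn_injective : Function.Injective fn := by
  intro s s' h
  have h' := congrFun h
  cases s
  cases s'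
  congr
  exacts [h' (.inl .input), h' (.inl .output), h' (.inl .query), h' (.inl .answer),
    h' (.inr .acc), h' (.inr .n), h' (.inr .A), h' (.inr .M), h' (.inr .t), h' (.inr .R),
    h' (.inr .T), h' (.inr .c), h' (.inr .C), h' (.inr .B), h' (.inr .k)]

end Regs

/-- The programs that use the stacks described by `Regs`. -/
abbrev RProg := Prog (Port ⊕ Reg) fun _ => Bool

/-- With oracle `O`, the program `P` transforms `s` into `s'` in at most `B` steps. -/
def Runs (O : List Bool → Option (List Bool)) (P : RProg) (s s' : Regs) (B : ℕ) : Prop :=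
  ∃ t ≤ B, Prog.Exec (CountingProblem.queryStep O) P s.fn s'.fn t

namespace Runs

open Prog

variable {O : List Bool → Option (List Bool)} {P Q : RProg} {s s₁ s' : Regs} {B B' : ℕ}

theorem mono (h : Runs O P s s' B) (hB : B ≤ B') : Runs O P s s' B' :=
  let ⟨t, ht, he⟩ := h
  ⟨t, ht.trans hB, he⟩

theorem skip : Runs O skip s s 0 := ⟨0, le_rfl, .skip _⟩

theorem push (k b) : Runs O (push k b) s (s.set k (b :: s.fn k)) 1 :=
  ⟨1, le_rfl, by rw [Regs.set_fn]; exact .push ..⟩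

theorem seq (h₁ : Runs O P s s₁ B) (h₂ : Runs O Q s₁ s' B') :
    Runs O (.seq P Q) s s' (B + B') :=
  let ⟨t₁, ht₁, he₁⟩ := h₁
  let ⟨t₂, ht₂, he₂⟩ := h₂
  ⟨t₁ + t₂, add_le_add ht₁ ht₂, .seq he₁ he₂⟩

theorem pop_nil {k e f} (hk : s.fn k = []) (h : Runs O e s s' B) :
    Runs O (.pop k e f) s s' (B + 1) :=
  let ⟨t, ht, he⟩ := h
  ⟨t + 1, Nat.succ_le_succ ht, .pop_nil hk he⟩

theorem pop_cons {k e f b l} (hk : s.fn k = b :: l) (h : Runs O (f b) (s.set k l) s' B) :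
    Runs O (.pop k e f) s s' (B + 1) :=
  let ⟨t, ht, he⟩ := h
  ⟨t + 1, Nat.succ_le_succ ht, .pop_cons hk (by rwa [← Regs.set_fn])⟩

theorem loop_nil {k body} (hk : s.fn k = []) : Runs O (.loop k body) s s 1 :=
  ⟨1, le_rfl, .loop_nil hk⟩

theorem loop_cons {k body b l} (hk : s.fn k = b :: l) (h₁ : Runs O (body b) (s.set k l) s₁ B)
    (h₂ : Runs O (.loop k body) s₁ s' B') : Runs O (.loop k body) s s' (B + B' + 1) :=
  let ⟨t₁, ht₁, he₁⟩ := h₁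
  let ⟨t₂, ht₂, he₂⟩ := h₂
  ⟨t₁ + t₂ + 1, Nat.succ_le_succ (add_le_add ht₁ ht₂),
    .loop_cons hk (by rwa [← Regs.set_fn]) he₂⟩

theorem query {a} (h : O s.q = some a) : Runs O query s { s with q := [], a := a } 1 := by
  refine ⟨1, le_rfl, .query ?_⟩
  have h' : O (s.fn (.inl .query)) = some a := h
  rw [CountingProblem.queryStep, h', Option.map_some, ← Regs.set_fn, ← Regs.set_fn]
  rfl

/-- A loop that passes through the symbols `g v` for `v` in a list `L`. The state is given in
terms of the part of `L` already done and of the rest. -/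
theorem loop {V : Type*} {k body} {L : List V} (g : V → Bool) (st : List V → List V → Regs)
    (hk : ∀ d r, (st d r).fn k = r.map g)
    (hb : ∀ d v r, d ++ v :: r = L →
      Runs O (body (g v)) ((st d (v :: r)).set k (r.map g)) (st (d ++ [v]) r) B) :
    Runs O (.loop k body) (st [] L) (st L []) (L.length * (B + 1) + 1) := by
  suffices h : ∀ r d, d ++ r = L →
      Runs O (.loop k body) (st d r) (st L []) (r.length * (B + 1) + 1) from h L [] rfl
  intro r
  induction r with
  | nil =>
    intro d hd
    rw [List.append_nil] at hd
    rw [hd]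
    exact (loop_nil (hk _ _)).mono (by simp)
  | cons v r ih =>
    intro d hd
    refine (loop_cons (hk _ _) (hb d v r hd) (ih (d ++ [v]) (by simpa using hd))).mono ?_
    simp only [List.length_cons, Nat.succ_mul]
    omega

end Runs

/-! ### Basic stack routines. -/

namespace RProg

open Prog

variable {O : List Bool → Option (List Bool)} {s s' : Regs} {B : ℕ}

/-- Empty a stack. -/
def clear (x : Port ⊕ Reg) : RProg := loop x fun _ => skip

/-- Move the content of `x` on top of `y`, in reverse order. -/
def move (x y : Port ⊕ Reg) : RProg := loop x fun b => push y b

/-- Put a copy of `x` on top of `y`, by means of the stack `t`. -/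
def copy (x y : Port ⊕ Reg) : RProg :=
  seq (move x (.inr .t)) (loop (.inr .t) fun b => seq (push x b) (push y b))

/-- Push the symbols of a list. -/
def pushAll (x : Port ⊕ Reg) : List Bool → RProg
  | [] => skip
  | b :: l => seq (push x b) (pushAll x l)

/-- Execute programs one after the other. -/
def seqAll : List RProg → RProg
  | [] => skip
  | P :: l => seq P (seqAll l)

/-- Read at most `m` symbols from the stack `x`, and continue with the program that `K` assigns to
the string found. -/
def readAll (x : Port ⊕ Reg) (K : List Bool → RProg) : ℕ → List Bool → RProg
  | 0, l => K l
  | m + 1, l => pop x (K l) fun b => readAll x K m (l ++ [b])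

theorem runs_clear (x) : Runs O (clear x) s (s.set x []) ((s.fn x).length + 1) := by
  have h := Runs.loop (O := O) (k := x) (body := fun _ => skip) (L := s.fn x) (B := 0) id
    (fun _ r => s.set x r) (fun d r => by simp [Regs.fn_set_self]) fun d v r _ => by
      have : (s.set x (v :: r)).set x (r.map id) = s.set x r :=
        Regs.fn_injective (by simp [Regs.set_fn])
      rw [this]
      exact .skip
  have e : s.set x (s.fn x) = s := Regs.fn_injective (by simp [Regs.set_fn])
  simp only [e] at h
  exact h.mono (by omega)

theorem runs_move {x y} (hxy : x ≠ y) :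
    Runs O (move x y) s ((s.set x []).set y ((s.fn x).reverse ++ s.fn y))
      (2 * (s.fn x).length + 1) := by
  have h := Runs.loop (O := O) (k := x) (body := fun b => push y b) (L := s.fn x) (B := 1) id
    (fun d r => (s.set x r).set y (d.reverse ++ s.fn y))
    (fun d r => by simp [Regs.fn_set_self, Regs.fn_set_of_ne _ hxy]) fun d v r _ => by
      have : (s.set x r).set y ((d ++ [v]).reverse ++ s.fn y) =
          (((s.set x (v :: r)).set y (d.reverse ++ s.fn y)).set x (r.map id)).set y
            (v :: (((s.set x (v :: r)).set y (d.reverse ++ s.fn y)).set x (r.map id)).fn y) :=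
        Regs.fn_injective (by
          simp [Regs.set_fn, Function.update_of_ne hxy.symm]
          rw [Function.update_comm hxy.symm]
          simp)
      rw [this]
      exact .push ..
  have e : (s.set x (s.fn x)).set y ([].reverse ++ s.fn y) = s :=
    Regs.fn_injective (by simp [Regs.set_fn])
  simp only [e] at h
  exact h.mono (by omega)

/-- Moving `x` to the scratch stack reverses it, and pushing from there on both `x` and `y` restores
the order. -/
theorem runs_copy {x y} (hxy : x ≠ y) (hx : x ≠ .inr .t) (hy : y ≠ .inr .t) (ht : s.t = []) :
    Runs O (copy x y) s (s.set y (s.fn x ++ s.fn y)) (5 * (s.fn x).length + 2) := by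
  have h₁ := runs_move (O := O) (s := s) hx
  have h := Runs.loop (O := O) (k := .inr .t) (body := fun b => .seq (push x b) (push y b))
    (L := (s.fn x).reverse) (B := 2) id
    (fun d r => ((s.set x d.reverse).set y (d.reverse ++ s.fn y)).set (.inr .t) r)
    (fun d r => by simp [Regs.fn_set_self]) fun d v r _ => by
      have : ((s.set x (d ++ [v]).reverse).set y ((d ++ [v]).reverse ++ s.fn y)).set (.inr .t) r =
        ((((((s.set x d.reverse).set y (d.reverse ++ s.fn y)).set (.inr .t) (v :: r)).set (.inr .t)
          (r.map id)).set x (v :: ((((s.set x d.reverse).set y (d.reverse ++ s.fn y)).set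
            (.inr .t) (v :: r)).set (.inr .t) (r.map id)).fn x)).set y
            (v :: (((((s.set x d.reverse).set y (d.reverse ++ s.fn y)).set
            (.inr .t) (v :: r)).set (.inr .t) (r.map id)).set x
              (v :: ((((s.set x d.reverse).set y (d.reverse ++ s.fn y)).set
            (.inr .t) (v :: r)).set (.inr .t) (r.map id)).fn x)).fn y)) :=
        Regs.fn_injective (by
          funext j
          simp only [Regs.set_fn, Function.update_apply]
          by_cases h1 : j = x <;> by_cases h2 : j = y <;> by_cases h3 : j = .inr .t <;>
            simp_all)
      rw [this]
      exact (Runs.push x v).seq (.push y v)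
  have e : ((s.set x ([] : List Bool).reverse).set y (([] : List Bool).reverse ++ s.fn y)).set
      (.inr .t) (s.fn x).reverse = (s.set x []).set (.inr .t) ((s.fn x).reverse ++ s.fn (.inr .t)) := by
    have : s.fn (.inr .t) = [] := ht
    refine Regs.fn_injective ?_
    rw [this]
    funext j
    simp only [Regs.set_fn, Function.update_apply]
    by_cases h1 : j = x <;> by_cases h2 : j = y <;> by_cases h3 : j = .inr .t <;> simp_all
  have e' : ((s.set x (s.fn x).reverse.reverse).set y ((s.fn x).reverse.reverse ++ s.fn y)).set
      (.inr .t) [] = s.set y (s.fn x ++ s.fn y) := by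
    refine Regs.fn_injective ?_
    have : s.fn (.inr .t) = [] := ht
    simp only [Regs.set_fn, List.reverse_reverse, Function.update_eq_self]
    exact Function.update_eq_self_iff.2 (by rw [Function.update_of_ne hy.symm, this])
  rw [e, e'] at h
  exact (h₁.seq h).mono (by simp; omega)

theorem runs_pushAll (x l) : Runs O (pushAll x l) s (s.set x (l.reverse ++ s.fn x)) l.length := by
  induction l generalizing s with
  | nil =>
    have : s.set x ([].reverse ++ s.fn x) = s := Regs.fn_injective (by simp [Regs.set_fn])
    rw [this]
    exact .skip
  | cons b l ih =>
    have h := (Runs.push (O := O) (s := s) x b).seq ih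
    have : ((s.set x (b :: s.fn x)).set x (l.reverse ++ (s.set x (b :: s.fn x)).fn x)) =
        s.set x ((b :: l).reverse ++ s.fn x) :=
      Regs.fn_injective (by simp [Regs.set_fn])
    rw [this] at h
    exact h.mono (by simp; omega)

/-- The string read is remembered in the program point, so the continuation may compute with it
arbitrarily at no cost. This works because the length is below the fixed bound `m`. -/
theorem runs_readAll {x K} (m : ℕ) : ∀ {s : Regs} {l}, (s.fn x).length < m →
    Runs O (K (l ++ s.fn x)) (s.set x []) s' B → Runs O (readAll x K m l) s s' (B + m) := by
  induction m with
  | zero => exact fun h => absurd h (by simp)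
  | succ m ih =>
    intro s l hm h
    rcases hs : s.fn x with _ | ⟨b, l'⟩
    · have : s.set x [] = s := Regs.fn_injective (by rw [Regs.set_fn, ← hs, Function.update_eq_self])
      rw [hs, List.append_nil, this] at h
      exact (Runs.pop_nil hs h).mono (by omega)
    · refine (Runs.pop_cons hs (ih ?_ ?_)).mono (le_of_eq (add_assoc _ _ _))
      · rw [Regs.fn_set_self]
        rw [hs] at hm
        simpa using hm
      · have : (s.set x l').set x [] = s.set x [] := Regs.fn_injective (by simp [Regs.set_fn])
        rw [Regs.fn_set_self, this]
        simpa [hs] using h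

end RProg

/-! ### Adjacency matrices along lists of vertices; search and splitting. -/

namespace SimpleGraph

variable {V : Type*} (G : SimpleGraph V)

open Classical in
/-- The part of a row of the adjacency matrix that belongs to a list of vertices. -/
noncomputable def row (L : List V) (i : V) : List Bool := L.map fun j => decide (G.Adj i j)

/-- The rows of the adjacency matrix of the graph induced on a list of vertices. -/
noncomputable def matList (L : List V) : List Bool := L.flatMap (G.row L)

theorem length_row (L : List V) (i : V) : (G.row L i).length = L.length := by simp [row]

theorem length_matList (L : List V) : (G.matList L).length = L.length * L.length := by
  simp [matList, length_row]

/-- Reversing the string reverses both the order of the rows and each row. A matrix that a loop has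
left reversed on a stack is thus still an adjacency matrix, for the reversed list of vertices. -/
theorem reverse_matList (L : List V) : (G.matList L).reverse = G.matList L.reverse := by
  rw [matList, List.reverse_flatMap, matList]
  congr 1
  funext i
  simp [row]

open Classical in
/-- Add to a set of vertices the neighbours in `L` of its members. -/
noncomputable def expand (L : List V) (S : V → Bool) (j : V) : Bool :=
  S j || L.any fun i => S i && decide (G.Adj i j)

end SimpleGraph

namespace RProg

open Prog SimpleGraph

variable {O : List Bool → Option (List Bool)} {s s' : Regs} {V : Type*}

/-- Prepare the search: the mask `M` marks the first vertex, and `c` counts the other ones. -/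
def mkMask : RProg :=
  seq (loop (.inr .n) fun _ => seq (push (.inr .c) true) (push (.inr .M) false))
    (push (.inr .M) true)

theorem runs_mkMask (m : ℕ) :
    Runs O mkMask { s with n := List.replicate m true, c := [], M := [] }
      { s with n := [], c := List.replicate m true, M := true :: List.replicate m false }
      (m * 3 + 2) := by
  have h := Runs.loop (O := O) (k := .inr .n)
    (body := fun _ => seq (push (.inr .c) true) (push (.inr .M) false)) (L := List.replicate m ())
    (B := 2) (fun _ => true)
    (fun d r => { s with n := r.map fun _ => true, c := List.replicate d.length true,
                         M := List.replicate d.length false }) (fun _ _ => rfl) fun d v r _ => by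
      simp only [List.length_append, List.length_singleton, List.replicate_succ]
      exact (Runs.push (.inr .c) true).seq (.push (.inr .M) false)
  simp only [List.map_replicate, List.length_replicate] at h
  exact (h.seq (.push (.inr .M) true)).mono (by omega)

/-- If `m` holds, add to the mask `M` the bits on top of `T`; remove them from `T`. -/
def orRow (m : Bool) : RProg :=
  seq (loop (.inr .M) fun b => pop (.inr .T) skip fun a => push (.inr .t) (b || (m && a)))
    (move (.inr .t) (.inr .M))

theorem runs_orRow (L : List V) (S g : V → Bool) (m : Bool) (T' : List Bool) :
    Runs O (orRow m) { s with M := L.map S, T := L.map g ++ T', t := [] }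
      { s with M := L.map fun j => S j || (m && g j), T := T', t := [] } (5 * L.length + 2) := by
  have h := Runs.loop (O := O) (k := .inr .M)
    (body := fun b => pop (.inr .T) skip fun a => push (.inr .t) (b || (m && a))) (L := L)
    (B := 2) S (fun d r => { s with M := r.map S, T := r.map g ++ T',
                                    t := (d.map fun j => S j || (m && g j)).reverse })
    (fun _ _ => rfl) fun d v r _ => by
      have e : ((d ++ [v]).map fun j => S j || (m && g j)).reverse =
          (S v || (m && g v)) :: (d.map fun j => S j || (m && g j)).reverse := by simp
      simp only [e]
      exact .pop_cons rfl (.push (.inr .t) _)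
  have h' := h.seq (runs_move (x := .inr .t) (y := .inr .M) (by simp))
  simp only [Regs.fn, Regs.set, List.reverse_reverse, List.map_nil, List.append_nil,
    List.length_reverse, List.length_map, List.reverse_nil, List.nil_append] at h'
  exact h'.mono (by omega)

/-- Add to the mask `M` the neighbours of the vertices that it marks. -/
def expandMask : RProg :=
  seq (copy (.inr .M) (.inr .R)) (seq (copy (.inr .A) (.inr .T)) (loop (.inr .R) orRow))

/-- `R` keeps the old mask while `M` is being enlarged, so exactly the neighbours of the old set are
added. -/
theorem runs_expandMask (G : SimpleGraph V) (L : List V) (S : V → Bool) :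
    Runs O expandMask { s with M := L.map S, A := G.matList L, R := [], T := [], t := [] }
      { s with M := L.map (G.expand L S), A := G.matList L, R := [], T := [], t := [] }
      (10 * L.length * L.length + 8 * L.length + 5) := by
  classical
  have h₁ := runs_copy (O := O) (x := .inr .M) (y := .inr .R)
    (s := { s with M := L.map S, A := G.matList L, R := [], T := [], t := [] })
    (by simp) (by simp) (by simp) rfl
  have h₂ := runs_copy (O := O) (x := .inr .A) (y := .inr .T)
    (s := { s with M := L.map S, A := G.matList L, R := L.map S, T := [], t := [] })
    (by simp) (by simp) (by simp) rfl
  have h₃ := Runs.loop (O := O) (k := .inr .R) (body := orRow) (L := L)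
    (B := 5 * L.length + 2) S (fun d r =>
      { s with M := L.map fun j => S j || d.any fun i => S i && decide (G.Adj i j),
               A := G.matList L, R := r.map S, T := r.flatMap (G.row L), t := [] })
    (fun _ _ => rfl) fun d v r _ => by
      have e : ∀ j, (S j || (d ++ [v]).any fun i => S i && decide (G.Adj i j)) =
          ((S j || d.any fun i => S i && decide (G.Adj i j)) ||
            (S v && decide (G.Adj v j))) := by
        intro j
        rw [List.any_append, ← Bool.or_assoc]
        simp
      simp only [e]
      exact runs_orRow (s := { s with A := G.matList L, R := r.map S }) L _
        (fun j => decide (G.Adj v j)) (S v) (r.flatMap (G.row L))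
  simp only [Regs.fn, Regs.set, List.append_nil, List.length_map, length_matList, List.any_nil,
    Bool.or_false] at h₁ h₂ h₃
  refine (h₁.seq (h₂.seq h₃)).mono ?_
  ring_nf
  omega

theorem runs_expandMask_loop (G : SimpleGraph V) (L : List V) (S : V → Bool) (m : ℕ) :
    Runs O (loop (.inr .c) fun _ => expandMask)
      { s with c := List.replicate m true, M := L.map S, A := G.matList L, R := [], T := [],
               t := [] }
      { s with c := [], M := L.map ((G.expand L)^[m] S), A := G.matList L, R := [], T := [],
               t := [] }
      (m * (10 * L.length * L.length + 8 * L.length + 6) + 1) := by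
  have h := Runs.loop (O := O) (k := .inr .c) (body := fun _ => expandMask)
    (L := List.replicate m ()) (B := 10 * L.length * L.length + 8 * L.length + 5) (fun _ => true)
    (fun d r => { s with c := r.map fun _ => true, M := L.map ((G.expand L)^[d.length] S),
                         A := G.matList L, R := [], T := [], t := [] }) (fun _ _ => rfl)
    fun d v r _ => by
      simp only [List.length_append, List.length_singleton, Function.iterate_succ_apply']
      exact runs_expandMask (s := { s with c := r.map fun _ => true }) G L _
  simp only [List.map_replicate, List.length_replicate] at h
  exact h

/-- Distribute the entries of a row, according to the mask `M`, between the stacks `C` and `B`. -/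
def splitRow (m : Bool) : RProg :=
  seq (loop (.inr .M) fun b => pop (.inr .A) skip fun a => seq (push (.inr .t) b)
    (if m && b then push (.inr .C) a else if !m && !b then push (.inr .B) a else skip))
    (seq (move (.inr .t) (.inr .M)) (push (.inr (if m then .k else .n)) true))

/-- Split the matrix `A` into the part marked by the mask `M` and the rest. -/
def split : RProg :=
  seq (copy (.inr .M) (.inr .R)) (seq (loop (.inr .R) splitRow)
    (seq (clear (.inr .M)) (move (.inr .B) (.inr .A))))

theorem runs_splitRow (L : List V) (S g : V → Bool) (m : Bool) (A' C' B' k' n' : List Bool) :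
    Runs O (splitRow m)
      { s with M := L.map S, A := L.map g ++ A', t := [], C := C', B := B', k := k', n := n' }
      { s with M := L.map S, A := A', t := [],
               C := (if m then (L.filter S).map g else []).reverse ++ C',
               B := (if m then [] else (L.filter fun j => !S j).map g).reverse ++ B',
               k := if m then true :: k' else k', n := if m then n' else true :: n' }
      (6 * L.length + 3) := by
  have h := Runs.loop (O := O) (k := .inr .M)
    (body := fun b => pop (.inr .A) skip fun a => seq (push (.inr .t) b)
      (if m && b then push (.inr .C) a else if !m && !b then push (.inr .B) a else skip)) (L := L)
    (B := 3) S (fun d r => { s with M := r.map S, A := r.map g ++ A', t := (d.map S).reverse,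
                                    C := (if m then (d.filter S).map g else []).reverse ++ C',
                                    B := (if m then [] else
                                      (d.filter fun j => !S j).map g).reverse ++ B',
                                    k := k', n := n' })
    (fun _ _ => rfl) fun d v r _ => by
      have e : ((d ++ [v]).map S).reverse = S v :: (d.map S).reverse := by simp
      simp only [e, List.filter_append, List.filter_singleton]
      refine .pop_cons rfl (.seq (B := 1) (B' := 1) (.push (.inr .t) (S v)) ?_)
      cases m <;> cases hS : S v <;>
        simp only [Bool.and_false, Bool.and_true, Bool.not_false,
          Bool.not_true, if_true, Bool.false_eq_true, if_false, List.append_nil, cond_true,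
          cond_false, List.map_append, List.map_cons, List.map_nil, List.reverse_append,
          List.reverse_cons, List.reverse_nil, List.nil_append, List.cons_append]
      · exact .push (.inr .B) (g v)
      · exact Runs.skip.mono (by omega)
      · exact Runs.skip.mono (by omega)
      · exact .push (.inr .C) (g v)
  have h' := h.seq ((runs_move (x := .inr .t) (y := .inr .M) (by simp)).seq
    (.push (.inr (if m then .k else .n)) true))
  simp only [Regs.fn, Regs.set, List.reverse_reverse, List.map_nil, List.append_nil,
    List.length_reverse, List.length_map, List.reverse_nil, List.nil_append, List.filter_nil,
    ite_self] at h'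
  cases m <;> exact h'.mono (by omega)

/-- Only entries whose row and column lie on the same side survive. The matrix of the rest is turned
around once more when it moves from `B` to `A`; that of the component stays reversed in `C`. -/
theorem runs_split (G : SimpleGraph V) (L : List V) (S : V → Bool) :
    Runs O split
      { s with M := L.map S, A := G.matList L, R := [], t := [], C := [], B := [], k := [],
               n := [] }
      { s with M := [], A := G.matList (L.filter fun j => !S j), R := [], t := [],
               C := (G.matList (L.filter S)).reverse, B := [],
               k := List.replicate (L.filter S).length true,
               n := List.replicate (L.filter fun j => !S j).length true }
      (8 * L.length * L.length + 10 * L.length + 5) := by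
  classical
  have h₁ := runs_copy (O := O) (x := .inr .M) (y := .inr .R)
    (s := { s with M := L.map S, A := G.matList L, R := [], t := [], C := [], B := [], k := [],
                   n := [] })
    (by simp) (by simp) (by simp) rfl
  have h₂ := Runs.loop (O := O) (k := .inr .R) (body := splitRow) (L := L)
    (B := 6 * L.length + 3) S (fun d r =>
      { s with M := L.map S, A := r.flatMap (G.row L), R := r.map S, t := [],
               C := ((d.filter S).flatMap (G.row (L.filter S))).reverse,
               B := ((d.filter fun j => !S j).flatMap (G.row (L.filter fun j => !S j))).reverse,
               k := List.replicate (d.filter S).length true,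
               n := List.replicate (d.filter fun j => !S j).length true })
    (fun _ _ => rfl) fun d v r _ => by
      have := runs_splitRow (O := O) (s := { s with R := r.map S }) L S
        (fun j => decide (G.Adj v j)) (S v) (r.flatMap (G.row L))
        ((d.filter S).flatMap (G.row (L.filter S))).reverse
        ((d.filter fun j => !S j).flatMap (G.row (L.filter fun j => !S j))).reverse
        (List.replicate (d.filter S).length true)
        (List.replicate (d.filter fun j => !S j).length true)
      simp only [List.filter_append, List.filter_singleton]
      cases hS : S v <;> simp only [hS, if_true, Bool.false_eq_true, if_false,
        List.reverse_nil, List.nil_append] at this <;>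
        simp only [Bool.not_false, Bool.not_true, cond_true, cond_false, List.append_nil,
          List.flatMap_append, List.flatMap_cons, List.flatMap_nil, List.reverse_append,
          List.length_append, List.length_singleton, List.replicate_succ]
      · exact this
      · exact this
  simp only [Regs.fn, Regs.set, List.append_nil] at h₁
  have h := h₁.seq (h₂.seq ((runs_clear (.inr .M)).seq
    (runs_move (x := .inr .B) (y := .inr .A) (by simp))))
  simp only [Regs.fn, Regs.set, List.reverse_reverse, List.map_nil, List.append_nil,
    List.length_reverse, List.length_map, List.flatMap_nil] at h
  refine h.mono ?_
  have h3 := G.length_matList (L.filter fun j => !S j)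
  rw [matList] at h3
  rw [h3]
  have h4 := Nat.mul_le_mul (List.length_filter_le (fun j => !S j) L)
    (List.length_filter_le (fun j => !S j) L)
  ring_nf at h4 ⊢
  omega

/-- Turn the list of vertices in `k` into the list of bits in which the last one is marked. -/
def markLast : RProg :=
  seq (pop (.inr .k) skip fun _ => skip) (seq (loop (.inr .k) fun _ => push (.inr .t) false)
    (seq (push (.inr .k) true) (move (.inr .t) (.inr .k))))

/-- The first vertex is the root of the search and belongs to its component. It comes last because
the component is stored in reverse order. -/
theorem runs_markLast (m : ℕ) :
    Runs O markLast { s with k := List.replicate (m + 1) true, t := [] }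
      { s with k := List.replicate m false ++ [true], t := [] } (4 * m + 4) := by
  have h := Runs.loop (O := O) (k := .inr .k) (body := fun _ => push (.inr .t) false)
    (L := List.replicate m ()) (B := 1) (fun _ => true)
    (fun d r => { s with k := r.map fun _ => true, t := List.replicate d.length false })
    (fun _ _ => rfl) fun d v r _ => by
      simp only [List.length_append, List.length_singleton, List.replicate_succ]
      exact .push (.inr .t) false
  simp only [List.map_replicate, List.length_replicate] at h
  have h' := (Runs.pop_cons (O := O) (k := .inr .k) (e := skip) (f := fun _ => skip)
    (s := { s with k := List.replicate (m + 1) true, t := [] }) (b := true)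
    (l := List.replicate m true) rfl .skip).seq (h.seq ((Runs.push (.inr .k) true).seq
      (runs_move (x := .inr .t) (y := .inr .k) (by simp))))
  simp only [Regs.fn, Regs.set, List.reverse_replicate, List.length_replicate, List.map_nil] at h'
  exact h'.mono (by omega)

end RProg

/-! ### Writing the encoding of a glued graph on the query stack. -/

namespace SimpleGraph

variable {V : Type*}

/-- The encoding of the graph induced on a list of vertices. -/
noncomputable def encList (G : SimpleGraph V) (L : List V) : List Bool :=
  List.replicate L.length true ++ false :: G.matList L

/-- The vertices of a glued graph: those of the gadget, and the members of a list `L`. -/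
def glueList (m : ℕ) (L : List V) : List (Fin m ⊕ V) :=
  (List.finRange m).map Sum.inl ++ L.map Sum.inr

variable {U : Type*} {J : SimpleGraph (Option U)} {G : SimpleGraph V} {v : V}

theorem glue_adj_inl_inl {i j} :
    (glue J G v).Adj (.inl i) (.inl j) ↔ J.Adj (some i) (some j) := Iff.rfl

theorem glue_adj_inl_inr {i a} :
    (glue J G v).Adj (.inl i) (.inr a) ↔ a = v ∧ J.Adj (some i) none := Iff.rfl

theorem glue_adj_inr_inl {i a} :
    (glue J G v).Adj (.inr a) (.inl i) ↔ a = v ∧ J.Adj (some i) none := Iff.rfl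

end SimpleGraph

namespace RProg

open Prog SimpleGraph

variable {O : List Bool → Option (List Bool)} {s s' : Regs} {V : Type*}

section query

open Classical in
/-- Write the part of a row of the adjacency matrix of a glued graph that belongs to a vertex of
the given graph; `b` tells whether this vertex is the root. -/
noncomputable def vertexRow {m : ℕ} (J : SimpleGraph (Option (Fin m))) (b : Bool) : RProg :=
  seq (copy (.inr .k) (.inr .R))
    (seq (loop (.inr .R) fun _ => pop (.inr .T) skip fun a => push (.inl .query) a)
      (pushAll (.inl .query) ((List.finRange m).reverse.map fun u => b && decide (J.Adj (some u) none))))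

open Classical in
/-- Write the row of the adjacency matrix of a glued graph that belongs to a vertex of the
gadget. -/
noncomputable def gadgetRow {m : ℕ} (J : SimpleGraph (Option (Fin m))) (u : Fin m) : RProg :=
  seq (copy (.inr .k) (.inr .R))
    (seq (loop (.inr .R) fun b => push (.inl .query) (b && decide (J.Adj (some u) none)))
      (pushAll (.inl .query) ((List.finRange m).reverse.map fun u' =>
        decide (J.Adj (some u) (some u')))))

/-- Write the number of vertices of a glued graph. -/
def header (m : ℕ) : RProg :=
  seq (push (.inl .query) false) (seq (copy (.inr .k) (.inr .R))
    (seq (loop (.inr .R) fun _ => push (.inl .query) true)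
      (pushAll (.inl .query) (List.replicate m true))))

/-- Write the encoding of a glued graph on the query stack. -/
noncomputable def buildQuery {m : ℕ} (J : SimpleGraph (Option (Fin m))) : RProg :=
  seq (copy (.inr .C) (.inr .T)) (seq (copy (.inr .k) (.inr .c))
    (seq (loop (.inr .c) (vertexRow J))
      (seq (seqAll ((List.finRange m).reverse.map (gadgetRow J))) (header m))))

/-- A bound for the time that `buildQuery` takes. -/
def buildCost (m n : ℕ) : ℕ :=
  13 * n * n + (8 * m + 16) * n + m * m + 4 * m + 10

variable (G : SimpleGraph V) (r : V) (D : List V) {m : ℕ} (J : SimpleGraph (Option (Fin m)))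

/-- The list is reversed because a stack is written from the end of the string to its beginning.
Beyond the old row there are entries only for the root, where they record which gadget vertices are
adjacent to `none`. -/
theorem row_glue_inr (i : V) [Decidable (i = r)] (J : SimpleGraph (Option (Fin m)))
    [∀ u, Decidable (J.Adj (some u) none)] :
    (glue J G r).row (glueList m D.reverse).reverse (.inr i) = G.row D i ++
      (List.finRange m).reverse.map fun u => decide (i = r) && decide (J.Adj (some u) none) := by
  classical
  simp only [row, glueList, List.reverse_append, List.map_append, List.map_reverse,
    List.reverse_reverse, List.map_map]
  congr 1
  congr 1
  refine List.map_congr_left fun u _ => ?_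
  rw [Bool.eq_iff_iff]
  simp [glue_adj_inr_inl]

theorem row_glue_inl (u : Fin m) [DecidableEq V] [DecidableRel J.Adj] :
    (glue J G r).row (glueList m D.reverse).reverse (.inl u) =
      (D.map fun j => decide (j = r) && decide (J.Adj (some u) none)) ++
        (List.finRange m).reverse.map fun u' => decide (J.Adj (some u) (some u')) := by
  classical
  simp only [row, glueList, List.reverse_append, List.map_append, List.map_reverse,
    List.reverse_reverse, List.map_map]
  congr 1
  · refine List.map_congr_left fun j _ => ?_
    rw [Bool.eq_iff_iff]
    simp [glue_adj_inl_inr]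
  · congr 1
    refine List.map_congr_left fun u' _ => ?_
    rw [Bool.eq_iff_iff]
    simp [glue_adj_inl_inl]

open Classical in
theorem runs_vertexRow (i : V) (q' T' : List Bool) :
    Runs O (vertexRow J (decide (i = r)))
      { s with k := D.map fun j => decide (j = r), T := G.row D i ++ T', R := [], t := [], q := q' }
      { s with k := D.map fun j => decide (j = r), T := T', R := [], t := [],
               q := ((glue J G r).row (glueList m D.reverse).reverse (.inr i)).reverse ++ q' }
      (8 * D.length + m + 3) := by
  have h₁ := runs_copy (O := O) (x := .inr .k) (y := .inr .R)
    (s := { s with k := D.map fun j => decide (j = r), T := G.row D i ++ T', R := [], t := [],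
                   q := q' })
    (by simp) (by simp) (by simp) rfl
  have h₂ := Runs.loop (O := O) (k := .inr .R)
    (body := fun _ => pop (.inr .T) skip fun a => push (.inl .query) a) (L := D) (B := 2)
    (fun j => decide (j = r)) (fun d e =>
      { s with k := D.map fun j => decide (j = r), T := G.row e i ++ T',
               R := e.map fun j => decide (j = r), t := [],
               q := (G.row d i).reverse ++ q' }) (fun _ _ => rfl) fun d v e _ => by
      have h : (G.row (d ++ [v]) i).reverse = decide (G.Adj i v) :: (G.row d i).reverse := by
        simp [row]
      simp only [h]
      exact .pop_cons rfl (.push (.inl .query) _)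
  simp only [Regs.fn, Regs.set, List.append_nil, List.length_map] at h₁
  have h := h₁.seq (h₂.seq (runs_pushAll (.inl .query)
    ((List.finRange m).reverse.map fun u => decide (i = r) && decide (J.Adj (some u) none))))
  rw [row_glue_inr, List.reverse_append, List.append_assoc]
  refine Runs.mono h ?_
  simp only [List.length_map, List.length_reverse, List.length_finRange]
  omega

open Classical in
theorem runs_gadgetRow (u : Fin m) (q' : List Bool) :
    Runs O (gadgetRow J u)
      { s with k := D.map fun j => decide (j = r), R := [], t := [], q := q' }
      { s with k := D.map fun j => decide (j = r), R := [], t := [],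
               q := ((glue J G r).row (glueList m D.reverse).reverse (.inl u)).reverse ++ q' }
      (7 * D.length + m + 3) := by
  have h₁ := runs_copy (O := O) (x := .inr .k) (y := .inr .R)
    (s := { s with k := D.map fun j => decide (j = r), R := [], t := [], q := q' })
    (by simp) (by simp) (by simp) rfl
  have h₂ := Runs.loop (O := O) (k := .inr .R)
    (body := fun b => push (.inl .query) (b && decide (J.Adj (some u) none))) (L := D) (B := 1)
    (fun j => decide (j = r)) (fun d e =>
      { s with k := D.map fun j => decide (j = r),
               R := e.map fun j => decide (j = r), t := [],
               q := (d.map fun j => decide (j = r) && decide (J.Adj (some u) none)).reverse ++ q' })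
    (fun _ _ => rfl) fun d v e _ => by
      simp only [List.map_append, List.map_cons, List.map_nil, List.reverse_append,
        List.reverse_singleton, List.singleton_append]
      exact .push (.inl .query) _
  simp only [Regs.fn, Regs.set, List.append_nil, List.length_map] at h₁
  have h := h₁.seq (h₂.seq (runs_pushAll (.inl .query)
    ((List.finRange m).reverse.map fun u' => decide (J.Adj (some u) (some u')))))
  rw [row_glue_inl, List.reverse_append, List.append_assoc]
  refine Runs.mono h ?_
  simp only [List.length_map, List.length_reverse, List.length_finRange]
  omega

theorem runs_seqAll {U : Type*} (P : U → RProg) (f : U → List Bool) {B : ℕ}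
    (h : ∀ u q', Runs O (P u) { s with q := q' } { s with q := (f u).reverse ++ q' } B)
    (l : List U) (q' : List Bool) :
    Runs O (seqAll (l.map P)) { s with q := q' } { s with q := (l.flatMap f).reverse ++ q' }
      (l.length * B) := by
  induction l generalizing q' with
  | nil => exact Runs.skip.mono (by simp)
  | cons u l ih =>
    have := (h u q').seq (ih _)
    rw [List.flatMap_cons, List.reverse_append, List.append_assoc]
    refine this.mono ?_
    rw [List.length_cons, Nat.succ_mul, add_comm]

theorem runs_header (k' : List Bool) (q' : List Bool) :
    Runs O (header m) { s with k := k', R := [], t := [], q := q' }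
      { s with k := k', R := [], t := [],
               q := List.replicate (m + k'.length) true ++ false :: q' }
      (7 * k'.length + m + 4) := by
  have h₁ := runs_copy (O := O) (x := .inr .k) (y := .inr .R)
    (s := { s with k := k', R := [], t := [], q := false :: q' }) (by simp) (by simp) (by simp) rfl
  have h₂ := Runs.loop (O := O) (k := .inr .R)
    (body := fun _ => push (.inl .query) true) (L := k') (B := 1)
    id (fun d e => { s with k := k', R := e.map id, t := [],
                            q := List.replicate d.length true ++ false :: q' })
    (fun _ _ => rfl) fun d v e _ => by
      simp only [List.length_append, List.length_singleton, List.replicate_succ]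
      exact .push (.inl .query) _
  simp only [Regs.fn, Regs.set, List.append_nil] at h₁
  rw [List.map_id] at h₂
  have h := (Runs.push (O := O) (s := { s with k := k', R := [], t := [], q := q' })
    (.inl .query) false).seq (h₁.seq (h₂.seq (runs_pushAll (.inl .query) (List.replicate m true))))
  rw [List.replicate_add, List.append_assoc]
  simp only [List.length_replicate, List.reverse_replicate] at h
  exact h.mono (by omega)

-- The string is produced backwards: rows of the vertices of the component, then rows of the gadget,
-- then the number of vertices. Since `D` is already reversed, it can be read in its own order.
open Classical in
theorem runs_buildQuery :
    Runs O (buildQuery J)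
      { s with C := G.matList D, k := D.map fun j => decide (j = r), T := [], R := [], t := [],
               c := [], q := [] }
      { s with C := G.matList D, k := D.map fun j => decide (j = r), T := [], R := [], t := [],
               c := [], q := (glue J G r).encList (glueList m D.reverse) }
      (buildCost m D.length) := by
  have h₁ := runs_copy (O := O) (x := .inr .C) (y := .inr .T)
    (s := { s with C := G.matList D, k := D.map fun j => decide (j = r), T := [], R := [],
                   t := [], c := [], q := [] }) (by simp) (by simp) (by simp) rfl
  have h₂ := runs_copy (O := O) (x := .inr .k) (y := .inr .c)
    (s := { s with C := G.matList D, k := D.map fun j => decide (j = r), T := G.matList D,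
                   R := [], t := [], c := [], q := [] }) (by simp) (by simp) (by simp) rfl
  have h₃ := Runs.loop (O := O) (k := .inr .c) (body := vertexRow J) (L := D)
    (B := 8 * D.length + m + 3) (fun j => decide (j = r)) (fun d e =>
      { s with C := G.matList D, k := D.map fun j => decide (j = r), T := e.flatMap (G.row D),
               R := [], t := [], c := e.map fun j => decide (j = r),
               q := (d.flatMap fun i => (glue J G r).row (glueList m D.reverse).reverse
                 (.inr i)).reverse })
    (fun _ _ => rfl) fun d v e _ => by
      simp only [List.flatMap_append, List.flatMap_singleton, List.reverse_append]
      exact runs_vertexRow (s := { s with C := G.matList D, c := e.map fun j => decide (j = r) })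
        G r D J v _ (e.flatMap (G.row D))
  have h₄ := runs_seqAll (O := O) (gadgetRow J)
    (fun u => (glue J G r).row (glueList m D.reverse).reverse (.inl u))
    (s := { s with C := G.matList D, k := D.map fun j => decide (j = r), T := [], R := [], t := [],
                   c := [] })
    (fun u q' => runs_gadgetRow (s := { s with C := G.matList D, T := [], c := [] }) G r D J u q')
    (List.finRange m).reverse (D.flatMap fun i => (glue J G r).row (glueList m D.reverse).reverse
      (.inr i)).reverse
  have h₅ := runs_header (O := O) (m := m) (s := { s with C := G.matList D, T := [], c := [] })
    (D.map fun j => decide (j = r))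
    ((((List.finRange m).reverse.flatMap fun u =>
      (glue J G r).row (glueList m D.reverse).reverse (.inl u)).reverse ++
      (D.flatMap fun i => (glue J G r).row (glueList m D.reverse).reverse (.inr i)).reverse))
  have e : (glue J G r).encList (glueList m D.reverse) =
      List.replicate (m + (D.map fun j => decide (j = r)).length) true ++ false ::
        ((((List.finRange m).reverse.flatMap fun u =>
      (glue J G r).row (glueList m D.reverse).reverse (.inl u)).reverse ++
      (D.flatMap fun i => (glue J G r).row (glueList m D.reverse).reverse (.inr i)).reverse)) := by
    rw [encList]
    congr 2
    · simp [glueList]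
    · rw [← List.reverse_append, ← List.reverse_reverse (glueList m D.reverse), ← reverse_matList,
        List.reverse_reverse, matList]
      congr 1
      have h : (glueList m D.reverse).reverse =
          D.map Sum.inr ++ (List.finRange m).reverse.map Sum.inl := by
        simp [glueList, List.map_reverse]
      rw [h, List.flatMap_append, List.flatMap_map, List.flatMap_map]
  simp only [Regs.fn, Regs.set, List.append_nil, List.length_map] at h₁ h₂
  rw [e]
  refine Runs.mono (h₁.seq (h₂.seq (h₃.seq (h₄.seq h₅)))) ?_
  simp only [length_matList, List.length_map, List.length_reverse, List.length_finRange, buildCost]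
  ring_nf
  omega

end query

end RProg

/-! ### One round: processing a component. -/

namespace RProg

open Prog SimpleGraph

variable {O : List Bool → Option (List Bool)} {s s' : Regs} {V : Type*} {p : ℕ}

/-- A gadget: a rooted graph and a coefficient. -/
abbrev Gadget (p : ℕ) : Type := (Σ m, SimpleGraph (Option (Fin m))) × ZMod p

/-- Query the oracle on the graphs obtained by gluing the gadgets of a list, and continue with the
linear combination of the answers; `F` is more than the length of the answers. -/
noncomputable def gadgetLoop (F : ℕ) (K : ZMod p → RProg) : List (Gadget p) → ZMod p → RProg
  | [], z => K z
  | J :: l, z => seq (buildQuery J.1.2) (seq query (readAll (.inl .answer)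
      (fun w => gadgetLoop F K l (z + J.2 * (Computability.decodeNat w : ZMod p))) F []))

/-- A bound for the time that the queries take for a component with `n` vertices. -/
def gadgetCost (F : ℕ) (l : List (Gadget p)) (n : ℕ) : ℕ :=
  (l.map fun J => buildCost J.1.1 n + 1 + F).sum

-- The partial sum `z` lives in the program point and not on a stack, which is possible as `ZMod p`
-- and the set of strings shorter than `F` are finite for a prime `p`. The continuation `K` receives
-- the total.
open Classical in
theorem runs_gadgetLoop (G : SimpleGraph V) (r : V) (D : List V) {F : ℕ} {K : ZMod p → RProg}
    {val : Gadget p → ℕ} {B : ℕ} (l : List (Gadget p))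
    (hO : ∀ J ∈ l, O ((glue J.1.2 G r).encList (glueList J.1.1 D.reverse)) =
      some (Computability.encodeNat (val J)))
    (hF : ∀ J ∈ l, (Computability.encodeNat (val J)).length < F) (z : ZMod p)
    (h : Runs O (K (z + (l.map fun J => J.2 * (val J : ZMod p)).sum))
      { s with C := G.matList D, k := D.map fun j => decide (j = r), T := [], R := [], t := [],
               c := [], q := [], a := [] } s' B) :
    Runs O (gadgetLoop F K l z)
      { s with C := G.matList D, k := D.map fun j => decide (j = r), T := [], R := [], t := [],
               c := [], q := [], a := [] } s' (B + gadgetCost F l D.length) := by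
  induction l generalizing z with
  | nil => simpa [gadgetLoop, gadgetCost] using h
  | cons J l ih =>
    have h₁ := runs_buildQuery (O := O) (s := { s with a := [] }) G r D J.1.2
    have h₂ := Runs.query (O := O) (s := { s with
      C := G.matList D, k := D.map fun j => decide (j = r), T := [], R := [], t := [],
      c := [], q := (glue J.1.2 G r).encList (glueList J.1.1 D.reverse), a := [] })
      (hO J List.mem_cons_self)
    have h₃ := ih (fun J hJ => hO J (List.mem_cons_of_mem _ hJ))
      (fun J hJ => hF J (List.mem_cons_of_mem _ hJ)) (z + J.2 * (val J : ZMod p)) (by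
        rwa [List.map_cons, List.sum_cons, ← add_assoc] at h)
    have h₄ := runs_readAll (O := O) (x := .inl .answer)
      (K := fun w => gadgetLoop F K l (z + J.2 * (Computability.decodeNat w : ZMod p))) (l := [])
      (s := { s with C := G.matList D, k := D.map fun j => decide (j = r), T := [], R := [],
                     t := [], c := [], q := [], a := Computability.encodeNat (val J) })
      (B := B + gadgetCost F l D.length) (s' := s') F (hF J List.mem_cons_self) (by
        simp only [Regs.fn, List.nil_append, Computability.decode_encodeNat]
        exact h₃)
    refine (h₁.seq (h₂.seq h₄)).mono ?_
    rw [gadgetCost, gadgetCost, List.map_cons, List.sum_cons]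
    omega

/-- Take the component of the first vertex off the graph, and multiply the accumulator by the
linear combination of the answers for this component. -/
noncomputable def component (F : ℕ) (l : List (Gadget p)) : RProg :=
  seq mkMask (seq (loop (.inr .c) fun _ => expandMask) (seq split (seq markLast
    (gadgetLoop F (fun z => seq (clear (.inr .C)) (seq (clear (.inr .k)) (readAll (.inr .acc)
      (fun w => pushAll (.inr .acc)
        (Computability.encodeNat ((Computability.decodeNat w : ZMod p) * z).val).reverse) F [])))
      l 0))))

/-- A bound for the time that `component` takes on a graph with `n` vertices. -/
def componentCost (F : ℕ) (l : List (Gadget p)) (n : ℕ) : ℕ :=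
  10 * n * n * n + 17 * n * n + 24 * n + 2 * F + 14 + gadgetCost F l n

/-- The contents of the stacks between two rounds: the list `L` of the vertices not yet dealt
with, and the value `z` of the accumulator. -/
noncomputable def roundRegs (s : Regs) (G : SimpleGraph V) (L : List V) (z : ZMod p) : Regs :=
  { s with q := [], a := [], acc := Computability.encodeNat z.val,
           n := List.replicate L.length true, A := G.matList L, M := [], t := [], R := [], T := [],
           c := [], C := [], B := [], k := [] }

open Classical in
/-- The vertices found by the search from the vertex `r` in the graph induced on `L`. -/
noncomputable def found (G : SimpleGraph V) (L : List V) (r : V) : V → Bool :=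
  (G.expand L)^[L.length - 1] fun v => decide (v = r)

theorem iterate_expand_of_true {G : SimpleGraph V} {L : List V} {S : V → Bool} {v : V}
    (h : S v = true) (m : ℕ) : (G.expand L)^[m] S v = true := by
  induction m with
  | zero => exact h
  | succ m ih => rw [Function.iterate_succ_apply', expand, ih, Bool.true_or]

theorem buildCost_mono (m : ℕ) : Monotone (buildCost m) := by
  intro a b h
  unfold buildCost
  gcongr

theorem gadgetCost_mono (F : ℕ) (l : List (Gadget p)) : Monotone (gadgetCost F l) := by
  intro a b h
  refine List.sum_le_sum fun J _ => ?_
  have := buildCost_mono J.1.1 h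
  omega

theorem componentCost_mono (F : ℕ) (l : List (Gadget p)) : Monotone (componentCost F l) := by
  intro a b h
  have := gadgetCost_mono F l h
  unfold componentCost
  gcongr

/-- The gadgets are glued at `r`, the first of the remaining vertices. The surrounding loop has
already removed one symbol from `n`, so `n` counts the other vertices, which is also the number of
rounds that the search needs. -/
theorem runs_component [NeZero p] (G : SimpleGraph V) (r : V) (L : List V)
    (hL : (r :: L).Nodup) {F : ℕ}
    (hF : ∀ x < p, (Computability.encodeNat x).length < F) (l : List (Gadget p))
    {val : Gadget p → ℕ} (hval : ∀ J ∈ l, val J < p)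
    (hO : ∀ J ∈ l, O ((glue J.1.2 G r).encList
      (glueList J.1.1 ((r :: L).filter (found G (r :: L) r)))) =
      some (Computability.encodeNat (val J))) (z : ZMod p) :
    Runs O (component F l) { roundRegs s G (r :: L) z with n := List.replicate L.length true }
      (roundRegs s G ((r :: L).filter fun v => !found G (r :: L) r v)
        (z * (l.map fun J => J.2 * (val J : ZMod p)).sum)) (componentCost F l (r :: L).length) := by
  classical
  obtain ⟨X, hX⟩ : ∃ X, (r :: L).filter (found G (r :: L) r) = r :: X := by
    have : found G (r :: L) r r = true := iterate_expand_of_true (by simp) _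
    exact ⟨_, List.filter_cons_of_pos this⟩
  have hlen : (r :: X).length ≤ (r :: L).length := hX ▸ List.length_filter_le _ _
  -- Without repetitions in the list, the initial mask marks `r` and nothing else.
  have hmask : true :: List.replicate L.length false = (r :: L).map fun v => decide (v = r) := by
    rw [List.map_cons, decide_eq_true rfl]
    congr 1
    refine (List.eq_replicate_iff.2 ⟨by simp, fun b hb => ?_⟩).symm
    obtain ⟨v, hv, rfl⟩ := List.mem_map.1 hb
    exact decide_eq_false fun h => (List.nodup_cons.1 hL).1 (h ▸ hv)
  -- Likewise the marked list in `k` marks `r` alone, as the last entry of the reversed component.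
  have hmark : List.replicate X.length false ++ [true] =
      (r :: X).reverse.map fun j => decide (j = r) := by
    have hX' : (r :: X).Nodup := hX ▸ hL.filter _
    rw [List.reverse_cons, List.map_append, List.map_singleton, decide_eq_true rfl]
    congr 1
    refine (List.eq_replicate_iff.2 ⟨by simp, fun b hb => ?_⟩).symm
    obtain ⟨v, hv, rfl⟩ := List.mem_map.1 hb
    exact decide_eq_false fun h => (List.nodup_cons.1 hX').1 (h ▸ List.mem_reverse.1 hv)
  have h₁ := runs_mkMask (O := O) (s := roundRegs s G (r :: L) z) L.length
  rw [hmask] at h₁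
  have h₂ := runs_expandMask_loop (O := O) (s := { roundRegs s G (r :: L) z with n := [] }) G
    (r :: L) (fun v => decide (v = r)) L.length
  have h₃ := runs_split (O := O) (s := roundRegs s G (r :: L) z) G (r :: L) (found G (r :: L) r)
  rw [hX, reverse_matList] at h₃
  have h₄ := runs_markLast (O := O) (s := { roundRegs s G
    ((r :: L).filter fun v => !found G (r :: L) r v) z with C := G.matList (r :: X).reverse })
    X.length
  rw [hmark] at h₄
  let s₅ : Regs := roundRegs s G ((r :: L).filter fun v => !found G (r :: L) r v) z
  let w : ZMod p := (l.map fun J => J.2 * (val J : ZMod p)).sum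
  have h₆ := runs_clear (O := O) (s := { s₅ with
    C := G.matList (r :: X).reverse, k := (r :: X).reverse.map fun j => decide (j = r) }) (.inr .C)
  have h₇ := runs_clear (O := O) (s := { s₅ with
    k := (r :: X).reverse.map fun j => decide (j = r) }) (.inr .k)
  have h₈ := runs_pushAll (O := O) (s := { s₅ with acc := [] }) (.inr .acc)
    (Computability.encodeNat (z * w).val).reverse
  have h₉ := runs_readAll (O := O) (x := .inr .acc) (s := s₅) (l := [])
    (K := fun u => pushAll (.inr .acc) (Computability.encodeNat
      ((Computability.decodeNat u : ZMod p) * w).val).reverse) F (hF _ z.val_lt) (by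
      simp only [s₅, roundRegs, Regs.fn, List.nil_append, Computability.decode_encodeNat,
        ZMod.natCast_val, ZMod.cast_id', id]
      exact h₈)
  have h₅ := runs_gadgetLoop (O := O) (s := s₅) (val := val) (F := F)
    (K := fun z => seq (clear (.inr .C)) (seq (clear (.inr .k)) (readAll (.inr .acc)
      (fun w => pushAll (.inr .acc)
        (Computability.encodeNat ((Computability.decodeNat w : ZMod p) * z).val).reverse) F [])))
    G r (r :: X).reverse l
    (by rw [List.reverse_reverse, ← hX]; exact hO) (fun J hJ => hF _ (hval J hJ)) 0
    (by rw [zero_add]; exact h₆.seq (h₇.seq h₉))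
  have e : ({ s₅ with acc := [] } : Regs).set (.inr .acc)
      ((Computability.encodeNat (z * w).val).reverse.reverse ++
        ({ s₅ with acc := [] } : Regs).fn (.inr .acc)) =
      roundRegs s G ((r :: L).filter fun v => !found G (r :: L) r v) (z * w) := by
    simp only [Regs.fn, Regs.set, List.reverse_reverse, List.append_nil]
    rfl
  rw [e] at h₅
  refine Runs.mono (h₁.seq (h₂.seq (h₃.seq (h₄.seq h₅)))) ?_
  have e₁ := gadgetCost_mono F l hlen
  have e₂ := hF (z * w).val (ZMod.val_lt _)
  have e₃ := Nat.mul_le_mul hlen hlen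
  simp only [Regs.fn, length_matList, List.length_map, List.length_reverse, componentCost]
  simp only [List.length_cons] at *
  ring_nf at *
  omega

end RProg

/-! ### The complete solver and its running time. -/

namespace RProg

open Prog SimpleGraph

variable {O : List Bool → Option (List Bool)} {s s' : Regs} {V : Type*} {p : ℕ}

/-- Split the encoding of a graph into the number of vertices and the matrix. -/
def parse : RProg :=
  seq (push (.inr .c) true) (seq
    (loop (.inr .c) fun _ => pop (.inl .query) skip fun b =>
      if b then seq (push (.inr .n) true) (push (.inr .c) true) else skip)
    (seq (move (.inl .query) (.inr .t)) (move (.inr .t) (.inr .A))))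

theorem runs_parse (n : ℕ) (l : List Bool) :
    Runs O parse
      { s with q := List.replicate n true ++ false :: l, n := [], A := [], t := [], c := [] }
      { s with q := [], n := List.replicate n true, A := l, t := [], c := [] }
      (4 * n + 4 * l.length + 6) := by
  -- The stack `c` serves as a flag: each `true` that is read raises it again, and the separator
  -- `false` does not, which stops the loop.
  have h : ∀ n j, Runs O (loop (.inr .c) fun _ => pop (.inl .query) skip fun b =>
      if b then seq (push (.inr .n) true) (push (.inr .c) true) else skip)
      { s with q := List.replicate n true ++ false :: l, n := List.replicate j true, A := [],
               t := [], c := [true] }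
      { s with q := l, n := List.replicate (j + n) true, A := [], t := [], c := [] }
      (4 * n + 3) := by
    intro n
    induction n with
    | zero =>
      intro j
      exact (Runs.loop_cons (s := { s with
        q := false :: l, n := List.replicate j true, A := [], t := [], c := [true] }) rfl
        (.pop_cons rfl .skip) (.loop_nil rfl)).mono (by omega)
    | succ n ih =>
      intro j
      have := ih (j + 1)
      rw [add_assoc, add_comm 1 n] at this
      rw [List.replicate_succ, List.cons_append]
      exact (Runs.loop_cons (s := { s with
        q := true :: (List.replicate n true ++ false :: l), n := List.replicate j true, A := [],
        t := [], c := [true] }) rfl (.pop_cons rfl (.seq (.push (.inr .n) true)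
          (.push (.inr .c) true))) this).mono (by omega)
  have h₁ := (Runs.push (O := O) (s := { s with
    q := List.replicate n true ++ false :: l, n := [], A := [], t := [], c := [] })
    (.inr .c) true).seq ((h n 0).seq ((runs_move (x := .inl .query) (y := .inr .t) (by simp)).seq
      (runs_move (x := .inr .t) (y := .inr .A) (by simp))))
  simp only [Regs.fn, Regs.set, List.append_nil, List.length_reverse, List.reverse_reverse,
    zero_add] at h₁
  exact h₁.mono (by omega)

/-- The program that computes the number of homomorphisms, as a product over the components. -/
noncomputable def solver (F : ℕ) (l : List (Gadget p)) : RProg :=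
  seq (clear (.inl .answer)) (seq parse
    (seq (pushAll (.inr .acc) (Computability.encodeNat (1 : ZMod p).val).reverse)
      (seq (loop (.inr .n) fun _ => component F l)
        (seq (move (.inr .acc) (.inr .t)) (move (.inr .t) (.inl .answer))))))

theorem length_filter_not_found_lt (G : SimpleGraph V) (r : V) (L : List V) :
    ((r :: L).filter fun v => !found G (r :: L) r v).length < (r :: L).length := by
  have : found G (r :: L) r r = true := iterate_expand_of_true (by simp) _
  rw [List.filter_cons_of_neg (by simp [this]), List.length_cons]
  exact Nat.lt_succ_of_le (List.length_filter_le _ _)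

/-- `N` abstracts the number of homomorphisms from the graph induced on a list: it is multiplicative
when a component is split off. A round removes a whole component, hence strong induction on the
length; there are at most as many rounds as vertices. -/
theorem runs_component_loop [NeZero p] (G : SimpleGraph V) {F : ℕ}
    (hF : ∀ x < p, (Computability.encodeNat x).length < F) (l : List (Gadget p))
    (N : List V → ZMod p) (h0 : N [] = 1)
    (hN : ∀ r L, (r :: L).Nodup → ∃ val : Gadget p → ℕ, (∀ J ∈ l, val J < p) ∧
      (∀ J ∈ l, O ((glue J.1.2 G r).encList
        (glueList J.1.1 ((r :: L).filter (found G (r :: L) r)))) =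
        some (Computability.encodeNat (val J))) ∧
      N (r :: L) = (l.map fun J => J.2 * (val J : ZMod p)).sum *
        N ((r :: L).filter fun v => !found G (r :: L) r v)) (m : ℕ) :
    ∀ (L : List V) (z : ZMod p), L.Nodup → L.length ≤ m →
      Runs O (loop (.inr .n) fun _ => component F l) (roundRegs s G L z)
        (roundRegs s G [] (z * N L)) (L.length * (componentCost F l m + 1) + 1) := by
  intro L
  induction hn : L.length using Nat.strong_induction_on generalizing L with
  | _ n ih =>
    intro z hL hm
    subst hn
    cases L with
    | nil =>
      rw [h0, mul_one]
      exact (Runs.loop_nil rfl).mono (by simp)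
    | cons r L =>
      obtain ⟨val, h₁, h₂, h₃⟩ := hN r L hL
      have hlt := length_filter_not_found_lt G r L
      have h₄ := ih _ hlt _ rfl (z * (l.map fun J => J.2 * (val J : ZMod p)).sum) (hL.filter _)
        (hlt.le.trans hm)
      rw [mul_assoc, ← h₃] at h₄
      refine (Runs.loop_cons (b := true) (l := List.replicate L.length true) rfl
        (runs_component G r L hL hF l h₁ h₂ z) h₄).mono ?_
      have e₁ := componentCost_mono F l hm
      have e₂ := Nat.mul_le_mul_right (componentCost F l m + 1) (Nat.le_of_lt_succ hlt)
      rw [List.length_cons, Nat.succ_mul]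
      rw [List.length_cons] at e₁
      omega

theorem runs_solver [NeZero p] (G : SimpleGraph V) {F : ℕ}
    (hF : ∀ x < p, (Computability.encodeNat x).length < F) (l : List (Gadget p))
    (N : List V → ZMod p) (h0 : N [] = 1)
    (hN : ∀ r L, (r :: L).Nodup → ∃ val : Gadget p → ℕ, (∀ J ∈ l, val J < p) ∧
      (∀ J ∈ l, O ((glue J.1.2 G r).encList
        (glueList J.1.1 ((r :: L).filter (found G (r :: L) r)))) =
        some (Computability.encodeNat (val J))) ∧
      N (r :: L) = (l.map fun J => J.2 * (val J : ZMod p)).sum *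
        N ((r :: L).filter fun v => !found G (r :: L) r v)) (i o a : List Bool)
    (L : List V) (hL : L.Nodup) {m : ℕ} (hm : (G.encList L).length ≤ m) (ha : a.length ≤ m) :
    Runs O (solver F l) ⟨i, o, G.encList L, a, [], [], [], [], [], [], [], [], [], [], []⟩
      ⟨i, o, [], Computability.encodeNat (N L).val, [], [], [], [], [], [], [], [], [], [], []⟩
      (m * (componentCost F l m + 1) + 9 * m + 5 * F + 20) := by
  have hlen : L.length + L.length * L.length + 1 = (G.encList L).length := by
    simp [encList, length_matList]
    omega
  have hLm : L.length ≤ m := by omega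
  let s : Regs := ⟨i, o, [], [], [], [], [], [], [], [], [], [], [], [], []⟩
  have h₁ := runs_clear (O := O) (s := { s with q := G.encList L, a := a }) (.inl .answer)
  have h₂ := runs_parse (O := O) (s := s) L.length (G.matList L)
  have h₃ := runs_pushAll (O := O)
    (s := { s with n := List.replicate L.length true, A := G.matList L }) (.inr .acc)
    (Computability.encodeNat (1 : ZMod p).val).reverse
  have h₄ := runs_component_loop (O := O) (s := s) G hF l N h0 hN m L 1 hL hLm
  have h₅ := runs_move (O := O) (s := { s with acc := Computability.encodeNat (N L).val })
    (x := .inr .acc) (y := .inr .t) (by simp)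
  have h₆ := runs_move (O := O) (s := { s with t := (Computability.encodeNat (N L).val).reverse })
    (x := .inr .t) (y := .inl .answer) (by simp)
  rw [one_mul] at h₄
  simp only [Regs.fn, Regs.set, List.append_nil, List.reverse_reverse, List.length_reverse,
    length_matList, s] at h₁ h₂ h₃ h₅ h₆
  have e₁ := hF _ (N L).val_lt
  have e₂ := hF _ (1 : ZMod p).val_lt
  have e₃ := Nat.mul_le_mul_right (componentCost F l m + 1) hLm
  refine Runs.mono (h₁.seq (h₂.seq (h₃.seq (h₄.seq (h₅.seq h₆))))) ?_
  omega

end RProg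

/-! ### Encodings along lists and multiplicativity of homomorphism counts. -/

namespace SimpleGraph

section lists

variable {V V' W : Type*}

theorem card_hom_congr {G : SimpleGraph V} {G' : SimpleGraph V'} (e : G ≃g G')
    (H : SimpleGraph W) : Nat.card (G →g H) = Nat.card (G' →g H) := by
  refine Nat.card_congr ⟨fun f => f.comp e.symm.toHom, fun f => f.comp e.toHom, fun f => ?_,
    fun f => ?_⟩
  · ext x
    simp
  · ext x
    simp

theorem encList_map (G : SimpleGraph V') (f : V → V') (L : List V) :
    G.encList (L.map f) = (G.comap f).encList L := by
  simp only [encList, matList, List.length_map, List.flatMap_map]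
  congr 3
  funext i
  simp [row, Function.comp_def]

theorem encodeGraph_eq_encList (n : ℕ) (G : SimpleGraph (Fin n)) :
    encodeGraph ⟨n, G⟩ = G.encList (List.finRange n) := by
  classical
  simp only [encodeGraph, encList, matList, List.length_finRange, List.ofFn_eq_map,
    List.flatMap_def]
  rfl

/-- The string depends only on the graph on the positions of the list, so it is a legitimate query.
-/
theorem encList_eq_encodeGraph (G : SimpleGraph V) (L : List V) :
    G.encList L = encodeGraph ⟨L.length, G.comap L.get⟩ := by
  rw [encodeGraph_eq_encList, ← encList_map, List.map_get_finRange]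

open Classical in
/-- A list that contains each vertex once gives a graph on its positions isomorphic to the given
one. -/
noncomputable def comapGetIso (G : SimpleGraph V) {L : List V} (hL : L.Nodup) (h : ∀ v, v ∈ L) :
    G.comap L.get ≃g G where
  toEquiv := hL.getEquivOfForallMemList L h
  map_rel_iff' := Iff.rfl

open Classical in
/-- The graph on the positions of a list is isomorphic to the graph induced on its members. -/
noncomputable def comapGetInduceIso (G : SimpleGraph V) {L : List V} (hL : L.Nodup) :
    G.comap L.get ≃g G.induce {v | v ∈ L} where
  toEquiv := hL.getEquiv L
  map_rel_iff' := Iff.rfl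

theorem glue_comap (G : SimpleGraph V) {m : ℕ} (J : SimpleGraph (Option (Fin m))) {f : V' → V}
    (hf : Function.Injective f) (v : V') :
    (glue J G (f v)).comap (Sum.map id f) = glue J (G.comap f) v := by
  ext (i | a) (j | b)
  · exact Iff.rfl
  · exact and_congr_left' hf.eq_iff
  · exact and_congr_left' hf.eq_iff
  · exact Iff.rfl

/-- The string written encodes the part of `glue J G _` on the gadget and `L`. This part is
isomorphic to the gadget glued to the graph on the positions of `L`, and isomorphic graphs have
equally many homomorphisms to `H`. -/
theorem oracle_glue (H : SimpleGraph W) (p : ℕ) (G : SimpleGraph V) {L : List V} (hL : L.Nodup)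
    (v : Fin L.length) {m : ℕ} (J : SimpleGraph (Option (Fin m))) :
    (homsToMod p H).oracle ((glue J G (L.get v)).encList (glueList m L)) =
      some (Computability.encodeNat (Nat.card (glue J (G.comap L.get) v →g H) % p)) := by
  let L₀ : List (Fin m ⊕ Fin L.length) :=
    (List.finRange m).map Sum.inl ++ (List.finRange L.length).map Sum.inr
  have hL₀ : glueList m L = L₀.map (Sum.map id L.get) := by
    have h : L.map Sum.inr = (List.finRange L.length).map fun i => (Sum.inr (L.get i) : Fin m ⊕ V) := by
      conv_lhs => rw [← List.map_get_finRange L, List.map_map]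
      rfl
    rw [glueList, h]
    simp [L₀, Function.comp_def]
  have hnd : L₀.Nodup := by
    refine List.Nodup.append ((List.nodup_finRange _).map Sum.inl_injective)
      ((List.nodup_finRange _).map Sum.inr_injective) ?_
    simp [List.disjoint_left]
  have hmem : ∀ x, x ∈ L₀ := by
    rintro (i | i) <;> simp [L₀]
  rw [hL₀, encList_map, glue_comap _ _ (List.nodup_iff_injective_get.1 hL),
    encList_eq_encodeGraph]
  refine ((homsToMod p H).oracle_encode ⟨L₀.length, _⟩).trans ?_
  simp only [homsToMod]
  rw [card_hom_congr (comapGetIso _ hnd hmem)]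

theorem card_hom_empty (G : SimpleGraph V) (H : SimpleGraph W) :
    Nat.card (G.comap ([] : List V).get →g H) = 1 := by
  have : Subsingleton (G.comap ([] : List V).get →g H) := ⟨fun f g => by
    ext x
    exact x.elim0⟩
  have : Nonempty (G.comap ([] : List V).get →g H) := ⟨⟨fun x => x.elim0, fun {x} => x.elim0⟩⟩
  exact Nat.card_eq_one_iff_unique.2 ⟨‹_›, ‹_›⟩

open Classical in
/-- The homomorphisms from a graph whose vertices are split into two parts without edges between
them. -/
theorem card_hom_induce_union (G : SimpleGraph V) (H : SimpleGraph W) (P S : V → Prop)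
    (hS : ∀ v w, P v → P w → G.Adj v w → (S v ↔ S w)) :
    Nat.card (G.induce {v | P v} →g H) =
      Nat.card (G.induce {v | P v ∧ S v} →g H) * Nat.card (G.induce {v | P v ∧ ¬S v} →g H) := by
  rw [← Nat.card_prod]
  refine Nat.card_congr ⟨fun f => (⟨fun v => f ⟨v.1, v.2.1⟩, fun {a b} h => f.map_rel h⟩,
    ⟨fun v => f ⟨v.1, v.2.1⟩, fun {a b} h => f.map_rel h⟩),
    fun g => ⟨fun v => if h : S v.1 then g.1 ⟨v.1, v.2, h⟩ else g.2 ⟨v.1, v.2, h⟩, ?_⟩, ?_, ?_⟩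
  · intro v w h
    have hvw := hS v w v.2 w.2 h
    by_cases hv : S v
    · have hw := hvw.1 hv
      simp only [hv, hw, dif_pos]
      exact g.1.map_rel (a := ⟨v.1, v.2, hv⟩) (b := ⟨w.1, w.2, hw⟩) h
    · have hw : ¬S w := fun hw => hv (hvw.2 hw)
      simp only [hv, hw, dif_neg, not_false_eq_true]
      exact g.2.map_rel (a := ⟨v.1, v.2, hv⟩) (b := ⟨w.1, w.2, hw⟩) h
  · intro f
    ext v
    by_cases hv : S v <;> simp
  · rintro ⟨g₁, g₂⟩
    refine Prod.ext ?_ ?_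
    · ext v
      simp [v.2.2]
    · ext v
      simp [v.2.2]

theorem card_hom_filter (G : SimpleGraph V) (H : SimpleGraph W) {L : List V} (hL : L.Nodup)
    (S : V → Bool) (hS : ∀ v w, v ∈ L → w ∈ L → G.Adj v w → (S v = true ↔ S w = true)) :
    Nat.card (G.comap L.get →g H) = Nat.card (G.comap (L.filter S).get →g H) *
      Nat.card (G.comap (L.filter fun v => !S v).get →g H) := by
  rw [card_hom_congr (comapGetInduceIso G hL), card_hom_congr (comapGetInduceIso G (hL.filter _)),
    card_hom_congr (comapGetInduceIso G (hL.filter _)),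
    card_hom_induce_union G H (· ∈ L) (fun v => S v = true) hS]
  have h₁ : {v | v ∈ L.filter S} = {v | v ∈ L ∧ S v = true} := Set.ext fun v => List.mem_filter
  have h₂ : {v | v ∈ L.filter fun v => !S v} = {v | v ∈ L ∧ ¬S v = true} := Set.ext fun v => by
    rw [Set.mem_ofPred_eq, List.mem_filter, Bool.not_eq_true', Set.mem_ofPred_eq, Bool.not_eq_true]
  rw [h₁, h₂]

end lists

/-! ### Correctness of the search: the vertices found form a component. -/

section search

variable {V : Type*} (G : SimpleGraph V)

theorem expand_of_true {L : List V} {S : V → Bool} {v : V} (h : S v = true) :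
    G.expand L S v = true := by
  rw [expand, h, Bool.true_or]

theorem expand_of_adj {L : List V} {S : V → Bool} {u v : V} (hu : u ∈ L) (h : S u = true)
    (huv : G.Adj u v) : G.expand L S v = true := by
  rw [expand, Bool.or_eq_true, List.any_eq_true]
  exact .inr ⟨u, hu, by simp [h, huv]⟩

theorem iterate_expand_mono {L : List V} {S : V → Bool} {v : V} {a b : ℕ} (hab : a ≤ b)
    (h : (G.expand L)^[a] S v = true) : (G.expand L)^[b] S v = true := by
  induction hab with
  | refl => exact h
  | step _ ih =>
    rw [Function.iterate_succ_apply']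
    exact G.expand_of_true ih

theorem iterate_expand_of_walk {L : List V} {S : V → Bool} {u v : {v | v ∈ L}}
    (w : (G.induce {v | v ∈ L}).Walk u v) : ∀ a, (G.expand L)^[a] S u = true →
      (G.expand L)^[a + w.length] S v = true := by
  induction w with
  | nil => exact fun a h => h
  | @cons u u' v h w ih =>
    intro a ha
    rw [Walk.length_cons, add_comm w.length 1, ← add_assoc]
    refine ih (a + 1) ?_
    rw [Function.iterate_succ_apply']
    exact G.expand_of_adj u.2 ha h

open RProg

theorem found_eq [DecidableEq V] (L : List V) (r : V) :
    found G L r = (G.expand L)^[L.length - 1] fun v => decide (v = r) := by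
  unfold found
  congr!

/-- A vertex that enters at stage k + 1 is adjacent to one present at stage k, which remains marked
to the end. The connecting path hence stays among the vertices found. -/
theorem induce_reachable_of_found {L : List V} {r : V} (hr : r ∈ L) {v : V} (hv : v ∈ L)
    (h : found G L r v = true) :
    (G.induce {v | v ∈ L ∧ found G L r v = true}).Reachable
      ⟨r, hr, iterate_expand_of_true (by simp) _⟩ ⟨v, hv, h⟩ := by
  classical
  suffices key : ∀ k ≤ L.length - 1, ∀ v, (hv : v ∈ L) → (h : found G L r v = true) →
      (G.expand L)^[k] (fun v => decide (v = r)) v = true →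
      (G.induce {v | v ∈ L ∧ found G L r v = true}).Reachable
        ⟨r, hr, iterate_expand_of_true (by simp) _⟩ ⟨v, hv, h⟩ by
    refine key _ le_rfl v hv h ?_
    rwa [← found_eq]
  intro k
  induction k with
  | zero =>
    intro _ v hv h hk
    obtain rfl : v = r := by simpa using hk
    exact Reachable.refl _
  | succ k ih =>
    intro hkm v hv h hk
    rw [Function.iterate_succ_apply', expand, Bool.or_eq_true, List.any_eq_true] at hk
    rcases hk with hk | ⟨u, hu, hk⟩
    · exact ih (by omega) v hv h hk
    · rw [Bool.and_eq_true, decide_eq_true_iff] at hk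
      have hu' : found G L r u = true := by
        have := G.iterate_expand_mono (show k ≤ L.length - 1 by omega) hk.1
        rwa [found_eq]
      exact (ih (by omega) u hu hu' hk.1).trans (Adj.reachable hk.2)

/-- The search is run long enough: a vertex reachable from `r` within `L` is joined to it by a path,
which has at most |L| - 1 edges, and each expansion follows one more edge. -/
theorem found_of_adj {L : List V} (hL : L.Nodup) {r : V} (hr : r ∈ L) {u v : V} (hu : u ∈ L)
    (hv : v ∈ L) (h : found G L r u = true) (huv : G.Adj u v) : found G L r v = true := by
  classical
  let φ : G.induce {v | v ∈ L ∧ found G L r v = true} →g G.induce {v | v ∈ L} :=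
    ⟨fun v => ⟨v.1, v.2.1⟩, fun {a b} h => h⟩
  have h₁ : (G.induce {v | v ∈ L}).Reachable ⟨r, hr⟩ ⟨v, hv⟩ :=
    ((G.induce_reachable_of_found hr hu h).map φ).trans
      (Adj.reachable (show (G.induce {v | v ∈ L}).Adj ⟨u, hu⟩ ⟨v, hv⟩ from huv))
  obtain ⟨w, hw⟩ := h₁.exists_isPath
  let : Fintype {v | v ∈ L} := Fintype.ofEquiv _ (hL.getEquiv L)
  have hlt := hw.length_lt
  have hcard : Fintype.card {v | v ∈ L} = L.length := by
    rw [Fintype.ofEquiv_card, Fintype.card_fin]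
  have := G.iterate_expand_of_walk (S := fun v => decide (v = r)) w 0 (by simp)
  have := G.iterate_expand_mono (show 0 + w.length ≤ L.length - 1 by omega) this
  rwa [found_eq]

theorem comap_reachable_of_found {r : V} {L : List V} (hL : (r :: L).Nodup)
    {X : List V} (hX : (r :: L).filter (found G (r :: L) r) = r :: X) (i : Fin (r :: X).length) :
    (G.comap (r :: X).get).Reachable 0 i := by
  have hnd : (r :: X).Nodup := hX ▸ hL.filter _
  have hmem : ∀ v, v ∈ r :: X ↔ v ∈ r :: L ∧ found G (r :: L) r v = true := fun v => by
    rw [← hX, List.mem_filter]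
  let e := comapGetInduceIso G hnd
  let φ : G.induce {v | v ∈ r :: L ∧ found G (r :: L) r v = true} →g G.induce {v | v ∈ r :: X} :=
    ⟨fun v => ⟨v.1, (hmem _).2 v.2⟩, fun {a b} h => h⟩
  have hi := (hmem _).1 ((r :: X).get_mem i)
  have h := ((G.induce_reachable_of_found List.mem_cons_self hi.1 hi.2).map φ).map e.symm.toHom
  have h₀ : e.symm (φ ⟨r, List.mem_cons_self, iterate_expand_of_true (by simp) _⟩) = 0 :=
    e.symm_apply_eq.2 rfl
  have h₁ : e.symm (φ ⟨(r :: X).get i, hi⟩) = i := e.symm_apply_eq.2 rfl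
  exact h₀ ▸ h₁ ▸ h

end search

end SimpleGraph

/-! ### Polynomial bounds and the conclusion. -/

namespace RProg

open SimpleGraph

variable {p : ℕ}

theorem exists_polynomial_gadgetCost (F : ℕ) (l : List (Gadget p)) :
    ∃ q : Polynomial ℕ, ∀ n, q.eval n = gadgetCost F l n := by
  induction l with
  | nil => exact ⟨0, fun n => by simp [gadgetCost]⟩
  | cons J l ih =>
    obtain ⟨q, hq⟩ := ih
    let b : Polynomial ℕ := 13 * .X * .X + (8 * .C J.1.1 + 16) * .X + .C J.1.1 * .C J.1.1 +
      4 * .C J.1.1 + 10 + 1 + .C F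
    refine ⟨b + q, fun n => ?_⟩
    rw [gadgetCost, List.map_cons, List.sum_cons, Polynomial.eval_add, hq]
    simp [b, gadgetCost, buildCost]

theorem exists_polynomial_solver (F : ℕ) (l : List (Gadget p)) :
    ∃ q : Polynomial ℕ, ∀ m,
      q.eval m = m * (componentCost F l m + 1) + 9 * m + 5 * F + 20 := by
  obtain ⟨g, hg⟩ := exists_polynomial_gadgetCost F l
  let c : Polynomial ℕ := 10 * .X * .X * .X + 17 * .X * .X + 24 * .X + 2 * .C F + 14 + g
  exact ⟨.X * (c + 1) + 9 * .X + 5 * .C F + 20, fun m => by simp [c, componentCost, hg]⟩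

end RProg

-- The set found is closed under adjacency within the list, which gives the product formula, and
-- connected from its first vertex, which makes the gadget identity `hl` applicable to it.
open SimpleGraph RProg in
theorem solves_homsToMod {V : Type*} [Finite V] {p : ℕ} [hp : Fact p.Prime] (H : SimpleGraph V)
    (H₁ : H.ConnectedComponent) (l : List (Gadget p))
    (hl : ∀ (n : ℕ) (G : SimpleGraph (Fin n)) (v : Fin n), (∀ u, G.Reachable v u) →
      (Nat.card (G →g H₁.toSimpleGraph) : ZMod p) =
        (l.map fun J => J.2 * (Nat.card (glue J.1.2 G v →g H) : ZMod p)).sum)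
    {F : ℕ} (hF : ∀ x < p, (Computability.encodeNat x).length < F) :
    CountingProblem.Solves (solver F l) (homsToMod p H₁.toSimpleGraph) (homsToMod p H)
      fun m => m * (componentCost F l m + 1) + 9 * m + 5 * F + 20 := by
  rintro ⟨n, G⟩ S m hq hm ha hW
  change S (.inl .query) = encodeGraph ⟨n, G⟩ at hq
  change (encodeGraph ⟨n, G⟩).length ≤ m at hm
  rw [encodeGraph_eq_encList] at hq hm
  have key := runs_solver (O := (homsToMod p H).oracle) G hF l
    (fun L => (Nat.card (G.comap L.get →g H₁.toSimpleGraph) : ZMod p))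
    (by rw [card_hom_empty, Nat.cast_one]) (by
      intro r L hL
      obtain ⟨X, hX⟩ : ∃ X, (r :: L).filter (found G (r :: L) r) = r :: X := by
        have : found G (r :: L) r r = true := iterate_expand_of_true (by simp) _
        exact ⟨_, List.filter_cons_of_pos this⟩
      have hnd : (r :: X).Nodup := hX ▸ hL.filter _
      -- The oracle answers with residues; position `0` is the root `r`.
      refine ⟨fun J => Nat.card (glue J.1.2 (G.comap (r :: X).get) 0 →g H) % p,
        fun J _ => Nat.mod_lt _ hp.out.pos, fun J _ => ?_, ?_⟩
      · rw [hX]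
        exact oracle_glue H p G hnd 0 J.1.2
      · rw [card_hom_filter G _ hL (found G (r :: L) r) fun v w hv hw h =>
          ⟨fun h' => found_of_adj G hL List.mem_cons_self hv hw h' h,
            fun h' => found_of_adj G hL List.mem_cons_self hw hv h' h.symm⟩, Nat.cast_mul, hX,
          hl _ _ 0 (comap_reachable_of_found G hL hX)]
        simp only [ZMod.natCast_mod])
    (S (.inl .input)) (S (.inl .output)) (S (.inl .answer)) (List.finRange n)
    (List.nodup_finRange n) hm ha
  obtain ⟨t, ht, he⟩ := key
  have h₁ : Regs.fn ⟨S (.inl .input), S (.inl .output), G.encList (List.finRange n),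
      S (.inl .answer), [], [], [], [], [], [], [], [], [], [], []⟩ = S := by
    funext j
    rcases j with (_ | _ | _ | _) | w
    · rfl
    · rfl
    · exact hq.symm
    · rfl
    · rw [hW]
      cases w <;> rfl
  have h₂ : Regs.fn ⟨S (.inl .input), S (.inl .output), [], Computability.encodeNat
      (Nat.card (G.comap (List.finRange n).get →g H₁.toSimpleGraph) : ZMod p).val,
      [], [], [], [], [], [], [], [], [], [], []⟩ =
      Function.update (Function.update S (.inl .query) []) (.inl .answer)
        (Computability.encodeNat ((homsToMod p H₁.toSimpleGraph).value ⟨n, G⟩)) := by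
    rw [ZMod.val_natCast, card_hom_congr (comapGetIso G (List.nodup_finRange n) List.mem_finRange)]
    funext j
    rcases j with (_ | _ | _ | _) | w
    · rfl
    · rfl
    · rfl
    · rfl
    · exact .trans (by cases w <;> rfl) (hW w).symm
  rw [h₁, h₂] at he
  exact ⟨t, ht, he⟩

theorem mainTheorem7 {V : Type*} [Finite V] (p : ℕ) (hp : p.Prime) (H : SimpleGraph V)
    (hH : ∀ φ : H ≃g H, orderOf φ ≠ p) (H₁ : H.ConnectedComponent)
    (hard : IsSharpModPHard p (homsToMod p H₁.toSimpleGraph)) :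
    IsSharpModPHard p (homsToMod p H) := by
  intro g hg
  have : Fact p.Prime := ⟨hp⟩
  obtain ⟨l, hl⟩ := SimpleGraph.exists_gadgets H hH H₁
  -- All residues modulo `p` have binary representations of length below a constant. This bounds
  -- both the answers that the solver reads and those that the simulated machine receives.
  obtain ⟨F, hF⟩ : ∃ F, ∀ x < p, (Computability.encodeNat x).length < F :=
    ⟨(Finset.range p).sup (fun x => (Computability.encodeNat x).length) + 1, fun x hx =>
      Nat.lt_succ_of_le (Finset.le_sup (f := fun x => (Computability.encodeNat x).length)
        (Finset.mem_range.2 hx))⟩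
  obtain ⟨q, hq⟩ := RProg.exists_polynomial_solver F l
  refine (hard g hg).of_solves q (P := RProg.solver F l) (D₀ := F) ?_ fun x => ?_
  · simp only [hq]
    exact solves_homsToMod H H₁ l hl hF
  · exact (hF _ (Nat.mod_lt _ hp.pos)).le
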